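/- **Definitions.** A *pregeometry* consists of a finite set $X$ of elements, a reflexive symmetric incidence relation $*$ on $X$, and a map $t$ from $X$ onto a set $I$ of types, such that distinct incident elements have distinct types; its *rank* is $|I|$. A *flag* is a set of pairwise incident elements, and a *chamber* is a flag containing one element of each type. A *geometry* is a pregeometry in which every flag is contained in a chamber; it is *thick* if every non-maximal flag is contained in at least three chambers. For distinct types $i,j$ the $\{i,j\}$-*truncation* is the restriction of the pregeometry to $t^{-1}(\{i,j\})$; it is *connected* if its incidence graph (distinct incident elements being adjacent) is connected. A group $G$ acting on $X$ by automorphisms (preserving types and incidence) is *flag-transitive* if for every $J\subseteq I$ it is transitive on the flags $F$ with $t(F)=J$. Let $G$ be a permutation group on a set $\Omega$. A *$G^\Omega$-uniform geometry* is a thick geometry, all of whose rank 2 truncations are connected, on which $G$ acts flag-transitively by automorphisms, and such that for every type $i$ the action of $G$ on $t^{-1}(i)$ is permutationally isomorphic to its action on $\Omega$ (that is, there are an automorphism $\psi$ of $G$ and a bijection $e:\Omega\to t^{-1}(i)$ with $e(g\omega)=\psi(g)e(\omega)$ for all $g\in G$, $\omega\in\Omega$). Let $G$ be a finite primitive permutation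 group on $\Omega$. Let $T$ denote a nonabelian simple group, and write $N_\alpha$ for the stabiliser in $N$ of $\alpha\in\Omega$. Then $G$ is of *O'Nan–Scott type* - HA, if it has an abelian minimal normal subgroup; - HS, if it has exactly two minimal normal subgroups, each isomorphic to some $T$; - HC, if it has exactly two minimal normal subgroups, each isomorphic to $T^n$ for some $T$ and some $n\ge 2$; - AS, if it has a unique minimal normal subgroup, isomorphic to some $T$; - SD, if it has a unique minimal normal subgroup $N$, with $N\cong T^n$ for some $T$ and some $n\ge2$, $N$ not regular on $\Omega$, and $N_\alpha\cong T$; - CD, if it has a unique minimal normal subgroup $N$, with $N\cong T^n$ for some $T$ and $n$, and $N_\alpha\cong T^\ell$ for some $\ell\ge2$; - TW, if it has a unique minimal normal subgroup $N$, with $N\cong T^n$ for some $T$ and some $n\ge2$, and $N$ regular on $\Omega$; - PA, if it has a unique minimal normal subgroup $N$, with $N\cong T^n$ for some $T$ and some $n\ge2$, $N_\alpha\ne1$, and $N_\alpha\not\cong T^\ell$ for every $\ell\ge1$. The conditions involving $\alpha$ are required for every $\alpha\in\Omega$. **Theorem.** Let $k$ be a positive integer. For each of the eight O'Nan–Scott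 types HA, HS, HC, AS, SD, CD, TW, PA there exist a finite set $\Omega$, a primitive permutation group $G$ of that type on $\Omega$, and a $G^\Omega$-uniform geometry of rank $k$. -/

import Mathlib

/-- A pregeometry with element set `X` and type set `I`: a reflexive symmetric incidence relation
`inc` and a type map `typ` from `X` onto `I`, such that distinct incident elements have distinct
types. -/
structure Pregeometry (X I : Type*) where
  inc : X → X → Prop
  typ : X → I
  typ_surjective : Function.Surjective typ
  inc_refl : ∀ x, inc x x
  inc_symm : ∀ x y, inc x y → inc y x
  typ_ne : ∀ x y, inc x y → x ≠ y → typ x ≠ typ y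

namespace Pregeometry

variable {X I : Type*}

/-- A flag is a set of pairwise incident elements. -/
def IsFlag (Γ : Pregeometry X I) (F : Set X) : Prop :=
  ∀ x ∈ F, ∀ y ∈ F, Γ.inc x y

/-- A chamber is a flag containing one element of each type. -/
def IsChamber (Γ : Pregeometry X I) (C : Set X) : Prop :=
  Γ.IsFlag C ∧ ∀ i : I, ∃! x, x ∈ C ∧ Γ.typ x = i

/-- A geometry is a pregeometry in which every flag is contained in a chamber. -/
def IsGeometry (Γ : Pregeometry X I) : Prop :=
  ∀ F : Set X, Γ.IsFlag F → ∃ C : Set X, Γ.IsChamber C ∧ F ⊆ C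

/-- A thick geometry: a geometry in which every non-maximal flag is contained in at least three
chambers. -/
def IsThickGeometry (Γ : Pregeometry X I) : Prop :=
  Γ.IsGeometry ∧
    ∀ F : Set X, Γ.IsFlag F → ¬ Maximal Γ.IsFlag F →
      3 ≤ {C : Set X | Γ.IsChamber C ∧ F ⊆ C}.encard

/-- The `J`-truncation: the restriction of the pregeometry to the elements with type in `J`. -/
def truncation (Γ : Pregeometry X I) (J : Set I) : Pregeometry {x : X // Γ.typ x ∈ J} J where
  inc x y := Γ.inc x y
  typ x := ⟨Γ.typ x, x.2⟩
  typ_surjective := by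
    rintro ⟨j, hj⟩
    obtain ⟨x, rfl⟩ := Γ.typ_surjective j
    exact ⟨⟨x, hj⟩, rfl⟩
  inc_refl x := Γ.inc_refl x
  inc_symm x y h := Γ.inc_symm x y h
  typ_ne x y h hne he :=
    Γ.typ_ne x y h (fun h' => hne (Subtype.ext h')) (congrArg Subtype.val he)

/-- The incidence graph: vertices are the elements, edges join distinct incident elements. -/
def incidenceGraph (Γ : Pregeometry X I) : SimpleGraph X where
  Adj x y := Γ.inc x y ∧ x ≠ y
  symm := ⟨fun x y h => ⟨Γ.inc_symm x y h.1, h.2.symm⟩⟩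
  loopless := ⟨fun _ h => h.2 rfl⟩

/-- For all distinct types `i`, `j`, the `{i, j}`-truncation is connected. -/
def HasConnectedRankTwoTruncations (Γ : Pregeometry X I) : Prop :=
  ∀ i j : I, i ≠ j → (Γ.truncation {i, j}).incidenceGraph.Connected

/-- The group `G`, acting on the set of elements, acts by (type-preserving) automorphisms. -/
def ActsByAutomorphisms (Γ : Pregeometry X I) (G : Type*) [Group G] [MulAction G X] : Prop :=
  ∀ g : G, (∀ x, Γ.typ (g • x) = Γ.typ x) ∧ ∀ x y, Γ.inc (g • x) (g • y) ↔ Γ.inc x y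

/-- `G` is flag-transitive: for every set `J` of types it is transitive on the flags of
type `J`. -/
def IsFlagTransitive (Γ : Pregeometry X I) (G : Type*) [Group G] [MulAction G X] : Prop :=
  ∀ J : Set I, ∀ F F' : Set X, Γ.IsFlag F → Γ.IsFlag F' → Γ.typ '' F = J → Γ.typ '' F' = J →
    ∃ g : G, (fun x => g • x) '' F = F'

/-- For the type `i`, the action of `G` on the set of elements of type `i` is permutationally
isomorphic to its action on `Ω`. -/
def ActionPermIsomorphic (Γ : Pregeometry X I) (G Ω : Type*) [Group G] [MulAction G Ω]
    [MulAction G X] (i : I) : Prop :=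
  ∃ (ψ : G ≃* G) (e : Ω ≃ {x : X // Γ.typ x = i}),
    ∀ (g : G) (ω : Ω), (e (g • ω) : X) = ψ g • (e ω : X)

/-- `Γ` is a `G^Ω`-uniform geometry. -/
structure IsUniform (Γ : Pregeometry X I) (G Ω : Type*) [Group G] [MulAction G Ω]
    [MulAction G X] : Prop where
  thick : Γ.IsThickGeometry
  connected : Γ.HasConnectedRankTwoTruncations
  automorphisms : Γ.ActsByAutomorphisms G
  flagTransitive : Γ.IsFlagTransitive G
  permIsomorphic : ∀ i : I, Γ.ActionPermIsomorphic G Ω i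

end Pregeometry

/-- A minimal normal subgroup: a minimal element among the nontrivial normal subgroups. -/
def IsMinimalNormal {G : Type*} [Group G] (N : Subgroup G) : Prop :=
  Minimal (fun K : Subgroup G => K.Normal ∧ K ≠ ⊥) N

def IsUniqueMinimalNormal {G : Type*} [Group G] (N : Subgroup G) : Prop :=
  ∀ K : Subgroup G, IsMinimalNormal K ↔ K = N

def IsNonabelianSimple (T : Type*) [Group T] : Prop :=
  IsSimpleGroup T ∧ ¬ ∀ a b : T, a * b = b * a

/-- The action of `N` on `Ω` is regular: transitive with trivial point stabilisers. -/
def ActsRegularly (N Ω : Type*) [Group N] [MulAction N Ω] : Prop :=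
  MulAction.IsPretransitive N Ω ∧ ∀ α : Ω, MulAction.stabilizer N α = ⊥

/-- The eight O'Nan-Scott types of primitive permutation groups. -/
inductive ONanScottType where
  | HA | HS | HC | AS | SD | CD | TW | PA

/-- The property that singles out each O'Nan-Scott type among the finite primitive permutation
groups. -/
def ONanScottType.DefiningProperty (τ : ONanScottType) (G Ω : Type) [Group G]
    [MulAction G Ω] : Prop :=
  match τ with
  | HA => ∃ N : Subgroup G, IsMinimalNormal N ∧ ∀ a ∈ N, ∀ b ∈ N, a * b = b * a
  | HS => ∃ (T : Type) (_ : Group T), IsNonabelianSimple T ∧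
      ∃ M N : Subgroup G, M ≠ N ∧ (∀ K : Subgroup G, IsMinimalNormal K ↔ K = M ∨ K = N) ∧
        Nonempty (M ≃* T) ∧ Nonempty (N ≃* T)
  | HC => ∃ (T : Type) (_ : Group T), IsNonabelianSimple T ∧ ∃ n : ℕ, 2 ≤ n ∧
      ∃ M N : Subgroup G, M ≠ N ∧ (∀ K : Subgroup G, IsMinimalNormal K ↔ K = M ∨ K = N) ∧
        Nonempty (M ≃* (Fin n → T)) ∧ Nonempty (N ≃* (Fin n → T))
  | AS => ∃ (T : Type) (_ : Group T), IsNonabelianSimple T ∧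
      ∃ N : Subgroup G, IsUniqueMinimalNormal N ∧ Nonempty (N ≃* T)
  | SD => ∃ (T : Type) (_ : Group T), IsNonabelianSimple T ∧ ∃ n : ℕ, 2 ≤ n ∧
      ∃ N : Subgroup G, IsUniqueMinimalNormal N ∧ Nonempty (N ≃* (Fin n → T)) ∧
        ¬ ActsRegularly N Ω ∧
        ∀ α : Ω, Nonempty (MulAction.stabilizer N α ≃* T)
  | CD => ∃ (T : Type) (_ : Group T), IsNonabelianSimple T ∧ ∃ n : ℕ, 1 ≤ n ∧
      ∃ N : Subgroup G, IsUniqueMinimalNormal N ∧ Nonempty (N ≃* (Fin n → T)) ∧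
        ∃ l : ℕ, 2 ≤ l ∧ ∀ α : Ω, Nonempty (MulAction.stabilizer N α ≃* (Fin l → T))
  | TW => ∃ (T : Type) (_ : Group T), IsNonabelianSimple T ∧ ∃ n : ℕ, 2 ≤ n ∧
      ∃ N : Subgroup G, IsUniqueMinimalNormal N ∧ Nonempty (N ≃* (Fin n → T)) ∧
        ActsRegularly N Ω
  | PA => ∃ (T : Type) (_ : Group T), IsNonabelianSimple T ∧ ∃ n : ℕ, 2 ≤ n ∧
      ∃ N : Subgroup G, IsUniqueMinimalNormal N ∧ Nonempty (N ≃* (Fin n → T)) ∧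
        ∀ α : Ω, MulAction.stabilizer N α ≠ ⊥ ∧
          ∀ l : ℕ, 1 ≤ l → IsEmpty (MulAction.stabilizer N α ≃* (Fin l → T))

/-- `G` is a finite primitive permutation group on `Ω` (a group acting faithfully and
primitively on a finite set with more than one point) of O'Nan-Scott type `τ`. -/
structure IsPrimitiveGroupOfType (τ : ONanScottType) (G Ω : Type) [Group G]
    [MulAction G Ω] : Prop where
  finite : Finite Ω
  nontrivial : Nontrivial Ω
  faithful : FaithfulSMul G Ω
  primitive : MulAction.IsPreprimitive G Ω
  property : τ.DefiningProperty G Ω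

open MulAction

open scoped Pointwise

/-! Take one copy of `Ω` for each type and let incidence between copies be given by `G`-invariant
relations. Then `G` acts on every type exactly as on `Ω`, so the permutational isomorphism is the
identity one. Primitivity gives connectedness of the rank 2 truncations, since sharing a neighbour
generates an invariant equivalence relation. Thickness reduces to three one-point extensions of
every partial flag at every missing type, and flag-transitivity to transitivity on chambers
(`Pregeometry.isUniform_ofRelations`).

For every type except AS the chambers are discrete geodesics: sequences of `k` points whose pairwise
distances are proportional to the differences of indices. `IsGeodesicSystem` lists what makes
partial geodesics extendable, and `three_le_encard_extension` derives the extension property from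
it. There are two models. In a power of `Δ` with the Hamming metric, one step changes two
coordinates along a self-paired orbital. In an alternating group, with distance the number of points
moved by `x⁻¹ * y`, one step multiplies by two disjoint 3-cycles. Two changes per step are needed
for thickness: with one change per step, a gap of length two would leave only two midpoints.

Chamber-transitivity comes from rigidity of geodesics. In the Hamming model each coordinate changes
at most once, so a geodesic is described by the jump times and jump values of its coordinates, and
`H ≀ S_m` matches these. In the alternating group the successive steps have disjoint supports, so
the steps of two geodesics are simultaneously conjugate, by an even permutation because points are
left over.

The groups are as follows. AS: `A_{k+5}` on points, incidence across types being distinctness, with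
flag-transitivity from multiple transitivity. HS and SD: `T × T` and `T ≀ S₂` acting on a large
alternating group `T`. The others are `H ≀ S_m` in product action, with `H` equal to `S₃` on 3
points (HA), `A₅ × A₅` on `A₅` (HC), `A₅ ≀ S₂` on `A₅` (CD), a twisted wreath product of `A₅` by
`A₆` (TW) and `A₅` on 5 points (PA). `WreathProduct.isPreprimitive` gives primitivity, and
`WreathProduct.exists_baseSubgroup_le` finds the minimal normal subgroups. The delicate factor is
the twisted wreath product, whose primitivity is `twistedBase.eq_bot_or_eq_top`. -/

/-- In a primitive action, an invariant symmetric relation holding for some pair of distinct points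
generates the full equivalence relation. -/
theorem MulAction.IsPreprimitive.reflTransGen {G Ω : Type*} [Group G] [MulAction G Ω]
    [IsPreprimitive G Ω] {s : Ω → Ω → Prop} (hsymm : ∀ x y, s x y → s y x)
    (hinv : ∀ (g : G) x y, s x y → s (g • x) (g • y)) {a b : Ω} (hab : a ≠ b) (h : s a b)
    (x : Ω) : Relation.ReflTransGen s a x := by
  have rsymm : ∀ {x y}, Relation.ReflTransGen s x y → Relation.ReflTransGen s y x := by
    intro x y h
    induction h with
    | refl => exact .refl
    | tail _ h ih => exact .head (hsymm _ _ h) ih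
  have rinv : ∀ (g : G) {x y}, Relation.ReflTransGen s x y →
      Relation.ReflTransGen s (g • x) (g • y) := by
    intro g x y h
    induction h with
    | refl => exact .refl
    | tail _ h ih => exact ih.tail (hinv g _ _ h)
  have hB : IsBlock G {y | Relation.ReflTransGen s a y} := by
    rw [isBlock_iff_smul_eq_or_disjoint]
    intro g
    refine or_iff_not_imp_right.2 fun hd => ?_
    obtain ⟨y, hy, hy'⟩ := Set.not_disjoint_iff.1 hd
    obtain ⟨z, hz, rfl⟩ := hy
    have hga : Relation.ReflTransGen s a (g • a) := hy'.trans (rsymm (rinv g hz))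
    ext w
    rw [Set.mem_smul_set_iff_inv_smul_mem]
    constructor
    · intro hw
      simpa using hga.trans (rinv g hw)
    · intro hw
      simpa using rinv g⁻¹ ((rsymm hga).trans hw)
  rcases IsPreprimitive.isTrivialBlock_of_isBlock hB with h1 | h1
  · exact absurd (h1 (Relation.ReflTransGen.refl) (Relation.ReflTransGen.single h)) hab
  · have : x ∈ {y | Relation.ReflTransGen s a y} := h1 ▸ Set.mem_univ x
    exact this

/-! ### Geometries on copies of `Ω` defined by binary relations -/

namespace Pregeometry

variable {I Ω : Type*}

/-- The pregeometry in which the elements of each type form a copy of `Ω`, with incidence between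
the copies of types `i` and `j` prescribed by the relation `E i j`. -/
def ofRelations [Nonempty Ω] (E : I → I → Ω → Ω → Prop) (hrefl : ∀ i x y, E i i x y ↔ x = y)
    (hsymm : ∀ i j x y, E i j x y → E j i y x) : Pregeometry (Σ _ : I, Ω) I where
  inc x y := E x.1 y.1 x.2 y.2
  typ x := x.1
  typ_surjective i := ⟨⟨i, Classical.arbitrary Ω⟩, rfl⟩
  inc_refl x := (hrefl _ _ _).2 rfl
  inc_symm x y h := hsymm _ _ _ _ h
  typ_ne := by
    rintro ⟨i, x⟩ ⟨j, y⟩ h hne rfl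
    obtain rfl : x = y := (hrefl _ _ _).1 h
    exact hne rfl

variable [Nonempty Ω] {E : I → I → Ω → Ω → Prop} {hrefl : ∀ i x y, E i i x y ↔ x = y}
  {hsymm : ∀ i j x y, E i j x y → E j i y x}

theorem isFlag_ofRelations_image (J : Set I) (x : I → Ω) :
    (ofRelations E hrefl hsymm).IsFlag ((fun j => ⟨j, x j⟩) '' J) ↔
      ∀ i ∈ J, ∀ j ∈ J, E i j (x i) (x j) := by
  constructor
  · intro h i hi j hj
    exact h _ ⟨i, hi, rfl⟩ _ ⟨j, hj, rfl⟩
  · rintro h _ ⟨i, hi, rfl⟩ _ ⟨j, hj, rfl⟩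
    exact h i hi j hj

/-- As `E i i` is equality, a flag meets each copy of `Ω` at most once, hence is the graph of a
partial function on types. Off those types the function `x` carries an arbitrary value. -/
theorem IsFlag.exists_eq_image {F : Set (Σ _ : I, Ω)}
    (hF : (ofRelations E hrefl hsymm).IsFlag F) :
    ∃ x : I → Ω, F = (fun j => (⟨j, x j⟩ : Σ _ : I, Ω)) '' (Sigma.fst '' F) := by
  classical
  refine ⟨fun j => if h : ∃ y, (⟨j, y⟩ : Σ _ : I, Ω) ∈ F then h.choose else Classical.arbitrary Ω,
    ?_⟩
  have key : ∀ j y, (⟨j, y⟩ : Σ _ : I, Ω) ∈ F →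
      (if h : ∃ y, (⟨j, y⟩ : Σ _ : I, Ω) ∈ F then h.choose else Classical.arbitrary Ω) = y := by
    intro j y hy
    have h : ∃ y, (⟨j, y⟩ : Σ _ : I, Ω) ∈ F := ⟨y, hy⟩
    rw [dif_pos h]
    exact (hrefl _ _ _).1 (hF _ h.choose_spec _ hy)
  ext ⟨j, y⟩
  constructor
  · intro h
    exact ⟨j, ⟨_, h, rfl⟩, congrArg (Sigma.mk j) (key j y h)⟩
  · rintro ⟨j', ⟨⟨i, z⟩, hz, rfl⟩, hj⟩
    simp only [key i z hz] at hj
    rwa [← hj]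

theorem isChamber_ofRelations_image {x : I → Ω} (h : ∀ i j, E i j (x i) (x j)) :
    (ofRelations E hrefl hsymm).IsChamber ((fun j => ⟨j, x j⟩) '' Set.univ) := by
  refine ⟨(isFlag_ofRelations_image _ _).2 fun i _ j _ => h i j, fun i => ?_⟩
  refine ⟨⟨i, x i⟩, ⟨⟨i, trivial, rfl⟩, rfl⟩, ?_⟩
  rintro _ ⟨⟨j, -, rfl⟩, rfl⟩
  rfl

omit [Nonempty Ω] in
-- Greedy: fill one missing type at a time, by induction on their number.
theorem exists_extension [Finite I]
    (hext : ∀ (J : Set I) (x : I → Ω), (∀ i ∈ J, ∀ j ∈ J, E i j (x i) (x j)) →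
      ∀ i ∉ J, 3 ≤ {z | ∀ j ∈ J, E i j z (x j)}.encard)
    (hrefl : ∀ i x y, E i i x y ↔ x = y) (hsymm : ∀ i j x y, E i j x y → E j i y x)
    (J : Set I) (x : I → Ω) (hx : ∀ i ∈ J, ∀ j ∈ J, E i j (x i) (x j)) :
    ∃ y : I → Ω, (∀ i j, E i j (y i) (y j)) ∧ ∀ j ∈ J, y j = x j := by
  classical
  induction h : Jᶜ.ncard using Nat.strong_induction_on generalizing J x with
  | _ n ih =>
  subst h
  by_cases hJ : J = Set.univ
  · subst hJ
    exact ⟨x, fun i j => hx i trivial j trivial, fun _ _ => rfl⟩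
  obtain ⟨i, hi⟩ := (Set.ne_univ_iff_exists_notMem J).1 hJ
  obtain ⟨z, hz⟩ : {z | ∀ j ∈ J, E i j z (x j)}.Nonempty := by
    rw [← Set.encard_pos]
    exact lt_of_lt_of_le (by norm_num) (hext J x hx i hi)
  have hne : ∀ j ∈ J, j ≠ i := fun j hj h => hi (h ▸ hj)
  obtain ⟨y, hy, hyx⟩ := ih (insert i J)ᶜ.ncard
    (Set.ncard_lt_ncard (compl_lt_compl_iff_lt.2 (Set.ssubset_insert hi))) (insert i J) (Function.update x i z) (by
        rintro a (rfl | ha) b (rfl | hb)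
        · simp [hrefl]
        · rw [Function.update_self, Function.update_of_ne (hne b hb)]
          exact hz b hb
        · rw [Function.update_self, Function.update_of_ne (hne a ha)]
          exact hsymm _ _ _ _ (hz a ha)
        · rw [Function.update_of_ne (hne a ha), Function.update_of_ne (hne b hb)]
          exact hx a ha b hb) rfl
  refine ⟨y, hy, fun j hj => ?_⟩
  rw [hyx j (Set.mem_insert_of_mem _ hj), Function.update_of_ne (hne j hj)]

variable [Finite I]
    (hext : ∀ (J : Set I) (x : I → Ω), (∀ i ∈ J, ∀ j ∈ J, E i j (x i) (x j)) →
      ∀ i ∉ J, 3 ≤ {z | ∀ j ∈ J, E i j z (x j)}.encard)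

include hext

theorem exists_extension_of_isFlag {F : Set (Σ _ : I, Ω)}
    (hF : (ofRelations E hrefl hsymm).IsFlag F) :
    ∃ y : I → Ω, (∀ i j, E i j (y i) (y j)) ∧
      F = (fun j => (⟨j, y j⟩ : Σ _ : I, Ω)) '' (Sigma.fst '' F) := by
  obtain ⟨x, hx⟩ := hF.exists_eq_image
  rw [hx] at hF
  obtain ⟨y, hy, hyx⟩ := exists_extension hext hrefl hsymm _ x
    ((isFlag_ofRelations_image _ _).1 hF)
  refine ⟨y, hy, hx.trans (Set.image_congr fun j hj => ?_)⟩
  rw [hyx j hj]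

/-- A non-maximal flag lies in a chamber and misses some type `i`. Each of the three or more
admissible points at `i` extends to a chamber, and chambers with different points at `i` differ. -/
theorem isThickGeometry_ofRelations : (ofRelations E hrefl hsymm).IsThickGeometry := by
  classical
  refine ⟨fun F hF => ?_, fun F hF hmax => ?_⟩
  · obtain ⟨y, hy, hF'⟩ := exists_extension_of_isFlag hext hF
    refine ⟨_, isChamber_ofRelations_image hy, ?_⟩
    rw [hF']
    exact Set.image_mono (Set.subset_univ _)
  · obtain ⟨x, hx, hF'⟩ := exists_extension_of_isFlag hext hF
    generalize Sigma.fst '' F = J at hF'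
    subst hF'
    have hJ : J ≠ Set.univ := by
      rintro rfl
      refine hmax ⟨hF, fun F' hF₁ hle => ?_⟩
      rintro ⟨i, y⟩ hy
      have := hF₁ _ (hle ⟨i, trivial, rfl⟩) _ hy
      exact ⟨i, trivial, congrArg (Sigma.mk i) ((hrefl _ _ _).1 this)⟩
    obtain ⟨i, hi⟩ := (Set.ne_univ_iff_exists_notMem J).1 hJ
    have hne : ∀ j ∈ J, j ≠ i := fun j hj h => hi (h ▸ hj)
    have hz : ∀ z ∈ {z | ∀ j ∈ J, E i j z (x j)}, ∃ y : I → Ω, (∀ i j, E i j (y i) (y j)) ∧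
        (∀ j ∈ J, y j = x j) ∧ y i = z := by
      intro z hz
      obtain ⟨y, hy, hyx⟩ := exists_extension hext hrefl hsymm (insert i J)
        (Function.update x i z) (by
          rintro a (rfl | ha) b (rfl | hb)
          · simp [hrefl]
          · rw [Function.update_self, Function.update_of_ne (hne b hb)]
            exact hz b hb
          · rw [Function.update_self, Function.update_of_ne (hne a ha)]
            exact hsymm _ _ _ _ (hz a ha)
          · rw [Function.update_of_ne (hne a ha), Function.update_of_ne (hne b hb)]
            exact hx a b)
      refine ⟨y, hy, fun j hj => ?_, ?_⟩
      · rw [hyx j (Set.mem_insert_of_mem _ hj), Function.update_of_ne (hne j hj)]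
      · rw [hyx i (Set.mem_insert _ _), Function.update_self]
    choose! y hy hyx hyz using hz
    refine (hext J x (fun i _ j _ => hx i j) i hi).trans ?_
    have hinj : Set.InjOn (fun z => (fun j => (⟨j, y z j⟩ : Σ _ : I, Ω)) '' Set.univ)
        {z | ∀ j ∈ J, E i j z (x j)} := by
      intro z hz z' hz' h
      have : (⟨i, y z i⟩ : Σ _ : I, Ω) ∈ (fun j => (⟨j, y z' j⟩ : Σ _ : I, Ω)) '' Set.univ :=
        (show _ = _ from h).subset ⟨i, trivial, rfl⟩
      obtain ⟨j, -, hj⟩ := this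
      obtain ⟨rfl, hj⟩ := Sigma.mk.inj_iff.1 hj
      rw [← hyz z hz, ← hyz z' hz', eq_of_heq hj]
    rw [← hinj.encard_image]
    refine Set.encard_le_encard ?_
    rintro _ ⟨z, hz, rfl⟩
    refine ⟨isChamber_ofRelations_image (hy z hz), ?_⟩
    rintro _ ⟨j, hj, rfl⟩
    exact ⟨j, trivial, by simp only [hyx z hz j hj]⟩

omit [Nonempty Ω] [Finite I] in
theorem exists_rel (hrefl : ∀ i x y, E i i x y ↔ x = y) (i j : I) (hij : i ≠ j) (y : Ω) : 3 ≤ {z | E i j z y}.encard := by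
  simpa [hrefl] using hext {j} (fun _ => y) (by simp [hrefl]) i (by simpa using hij)

variable {G : Type*} [Group G] [MulAction G Ω]
  (hinv : ∀ (g : G) i j x y, E i j x y → E i j (g • x) (g • y))

include hinv

omit [Finite I] in
-- Having a common neighbour of type `j` is a symmetric invariant relation on the points of type
-- `i`, and it relates two distinct points because neighbourhoods have at least three elements.
-- Primitivity then links all points of type `i`, and each point of type `j` has a neighbour among
-- them.
theorem hasConnectedRankTwoTruncations_ofRelations [IsPreprimitive G Ω] :
    (ofRelations E hrefl hsymm).HasConnectedRankTwoTruncations := by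
  intro i j hij
  set A := ((ofRelations E hrefl hsymm).truncation {i, j}).incidenceGraph
  let u : Ω → {x : Σ _ : I, Ω // (ofRelations E hrefl hsymm).typ x ∈ ({i, j} : Set I)} :=
    fun x => ⟨⟨i, x⟩, Or.inl rfl⟩
  let v : Ω → {x : Σ _ : I, Ω // (ofRelations E hrefl hsymm).typ x ∈ ({i, j} : Set I)} :=
    fun x => ⟨⟨j, x⟩, Or.inr rfl⟩
  have hadj : ∀ x y, E i j x y → A.Adj (u x) (v y) := by
    intro x y h
    refine ⟨h, fun he => hij ?_⟩
    exact congrArg (fun w => w.1.1) he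
  have h3 := exists_rel hext hrefl
  have hne : ∀ i j, i ≠ j → ∀ y, ∃ z, E i j z y := fun i j hij y =>
    Set.encard_pos.1 (lt_of_lt_of_le (by norm_num) (h3 i j hij y))
  obtain ⟨y₀⟩ := ‹Nonempty Ω›
  obtain ⟨a, b, ha, hb, hab⟩ := Set.one_lt_encard_iff.1
    (lt_of_lt_of_le (by norm_num) (h3 i j hij y₀))
  have htot := IsPreprimitive.reflTransGen (G := G) (s := fun x y => ∃ z, E i j x z ∧ E i j y z)
    (fun x y ⟨z, h, h'⟩ => ⟨z, h', h⟩)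
    (fun g x y ⟨z, h, h'⟩ => ⟨g • z, hinv g _ _ _ _ h, hinv g _ _ _ _ h'⟩) hab ⟨y₀, ha, hb⟩
  have hu : ∀ x, A.Reachable (u a) (u x) := by
    intro x
    induction htot x with
    | refl => exact .refl _
    | tail _ h ih =>
      obtain ⟨z, h, h'⟩ := h
      exact ih.trans ((hadj _ _ h).reachable.trans (hadj _ _ h').symm.reachable)
  have hall : ∀ w, A.Reachable (u a) w := by
    rintro ⟨⟨l, x⟩, rfl | rfl⟩
    · exact hu x
    · obtain ⟨z, hz⟩ := hne i l hij x
      exact (hu z).trans (hadj _ _ hz).reachable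
  have : Nonempty {x : Σ _ : I, Ω // (ofRelations E hrefl hsymm).typ x ∈ ({i, j} : Set I)} :=
    ⟨u a⟩
  exact ⟨fun x y => (hall x).symm.trans (hall y)⟩

/-- Two flags of the same type are completed to chambers; an element moving one chamber to the other
type by type also moves the flags. -/
theorem isUniform_ofRelations [IsPreprimitive G Ω]
    (htrans : ∀ x y : I → Ω, (∀ i j, E i j (x i) (x j)) → (∀ i j, E i j (y i) (y j)) →
      ∃ g : G, ∀ i, g • x i = y i) :
    (ofRelations E hrefl hsymm).IsUniform G Ω where
  thick := isThickGeometry_ofRelations hext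
  connected := hasConnectedRankTwoTruncations_ofRelations hext hinv
  automorphisms g := by
    refine ⟨fun x => rfl, fun x y => ⟨fun h => ?_, fun h => hinv g _ _ _ _ h⟩⟩
    have h' := hinv g⁻¹ _ _ _ _ h
    change E x.1 y.1 (g⁻¹ • g • x.2) (g⁻¹ • g • y.2) at h'
    rwa [inv_smul_smul, inv_smul_smul] at h'
  flagTransitive := by
    intro J F F' hF hF' hJ hJ'
    obtain ⟨x, hx, h⟩ := exists_extension_of_isFlag hext hF
    obtain ⟨y, hy, h'⟩ := exists_extension_of_isFlag hext hF'
    obtain ⟨g, hg⟩ := htrans x y hx hy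
    refine ⟨g, ?_⟩
    have e1 : Sigma.fst '' F = J := hJ
    have e2 : Sigma.fst '' F' = J := hJ'
    rw [h, h', e1, e2, Set.image_image]
    refine Set.image_congr fun j _ => ?_
    rw [Sigma.smul_mk, hg]
  permIsomorphic i := by
    refine ⟨MulEquiv.refl G, ⟨fun ω => ⟨⟨i, ω⟩, rfl⟩, fun x => x.1.2, fun _ => rfl, ?_⟩,
      fun g ω => rfl⟩
    rintro ⟨⟨j, x⟩, rfl⟩
    rfl

end Pregeometry

/-! ### Geodesic systems -/

/-- A family of symmetric relations `D n`, describing pairs of points at distance `w * n`, for which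
geodesics can be refined and prolonged up to length `w * K`. -/
structure IsGeodesicSystem {Ω : Type*} (K w : ℕ) (d : Ω → Ω → ℕ) (D : ℕ → Ω → Ω → Prop) :
    Prop where
  zero : ∀ x y, D 0 x y ↔ x = y
  symm : ∀ n x y, D n x y → D n y x
  dist_eq : ∀ n x y, D n x y → d x y = w * n
  triangle : ∀ x y z, d x z ≤ d x y + d y z
  comp : ∀ p q x y z, D p x y → D q y z → d x z = w * (p + q) → D (p + q) x z
  interp : ∀ s t x y, 0 < s → 0 < t → D (s + t) x y → 3 ≤ {z | D s x z ∧ D t z y}.encard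
  extend : ∀ n x y, D n x y → n ≤ K → ∃ z, D (K - n) y z ∧ d x z = w * K

namespace IsGeodesicSystem

variable {Ω : Type*} {K w : ℕ} {d : Ω → Ω → ℕ} {D : ℕ → Ω → Ω → Prop}
  (h : IsGeodesicSystem K w d D)

include h

/-- Prolong all the way to length `w * K`, then pick intermediate points on the added segment. Both
triangle inequalities are tight there, so the distance from `x` is exact. -/
theorem exists_prolongation {n s : ℕ} {x y : Ω} (hxy : D n x y) (hs : 0 < s) (hns : n + s < K) :
    3 ≤ {z | D s y z ∧ d x z = w * (n + s)}.encard := by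
  obtain ⟨Y, hY, hxY⟩ := h.extend n x y hxy (by omega)
  obtain ⟨t, rfl⟩ : ∃ t, K = n + s + t := ⟨K - (n + s), by omega⟩
  rw [show n + s + t - n = s + t by omega] at hY
  refine (h.interp s t y Y hs (by omega) hY).trans (Set.encard_le_encard ?_)
  rintro z ⟨hz, hz'⟩
  refine ⟨hz, ?_⟩
  have h1 := h.triangle x z Y
  have h2 := h.triangle x y z
  rw [hxY, h.dist_eq _ _ _ hz'] at h1
  rw [h.dist_eq _ _ _ hxy, h.dist_eq _ _ _ hz] at h2
  nlinarith

/-- The triangle inequality through `x` bounds `d a z` above and the one to `y` bounds it below by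
the same number; `comp` then turns the distance into the relation. -/
theorem rel_of_between {p s t : ℕ} {a x y z : Ω} (hax : D p a x) (hay : D (p + (s + t)) a y)
    (hxz : D s x z) (hzy : D t z y) : D (p + s) a z := by
  refine h.comp p s a x z hax hxz ?_
  have h1 := h.triangle a x z
  have h2 := h.triangle a z y
  rw [h.dist_eq _ _ _ hay, h.dist_eq _ _ _ hzy] at h2
  rw [h.dist_eq _ _ _ hax, h.dist_eq _ _ _ hxz] at h1
  nlinarith

theorem rel_of_beyond {p q s : ℕ} {a x y z : Ω} (hxa : D q x a) (hay : D p a y)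
    (hyz : D s y z) (hxz : d x z = w * (q + p + s)) : D (p + s) a z := by
  refine h.comp p s a y z hay hyz ?_
  have h1 := h.triangle a y z
  have h2 := h.triangle x a z
  rw [hxz, h.dist_eq _ _ _ hxa] at h2
  rw [h.dist_eq _ _ _ hay, h.dist_eq _ _ _ hyz] at h1
  nlinarith

/-- Partial geodesics have at least three one-point extensions at each missing position. -/
theorem three_le_encard_extension {k : ℕ} (hk : k < K) (hK : 1 < K) [Nonempty Ω]
    (J : Set (Fin k)) (x : Fin k → Ω)
    (hx : ∀ i ∈ J, ∀ j ∈ J, D (Nat.dist i j) (x i) (x j)) (i : Fin k) (hi : i ∉ J) :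
    3 ≤ {z | ∀ j ∈ J, D (Nat.dist i j) z (x j)}.encard := by
  have hcast : ∀ {a b : ℕ} {y z : Ω}, D a y z → a = b → D b y z := fun h e => e ▸ h
  have hne : ∀ j ∈ J, j ≠ i := fun j hj h => hi (h ▸ hj)
  by_cases hlo : ∃ j ∈ J, j < i
  · obtain ⟨a, ⟨haJ, hai⟩, ha⟩ := Set.exists_max_image {j | j ∈ J ∧ j < i} id (Set.toFinite _) hlo
    by_cases hup : ∃ j ∈ J, i < j
    · obtain ⟨b, ⟨hbJ, hbi⟩, hb⟩ :=
        Set.exists_min_image {j | j ∈ J ∧ i < j} id (Set.toFinite _) hup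
      have hab : D ((i - a : ℕ) + (b - i : ℕ)) (x a) (x b) :=
        hcast (hx a haJ b hbJ) (by simp only [Nat.dist]; omega)
      -- Relations to the two nearest present indices suffice: `rel_of_between` propagates them to
      -- all indices further out.
      refine (h.interp _ _ _ _ (by omega) (by omega) hab).trans (Set.encard_le_encard ?_)
      rintro z ⟨hz, hz'⟩ j hj
      rcases lt_or_gt_of_ne (hne j hj) with hji | hji
      · have hja := ha j ⟨hj, hji⟩
        simp only [id, Fin.le_def] at hja
        refine h.symm _ _ _ (hcast (h.rel_of_between (hx j hj a haJ)
          (hcast (hx j hj b hbJ) ?_) hz hz') ?_) <;> simp only [Nat.dist] <;> omega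
      · have hja := hb j ⟨hj, hji⟩
        simp only [id, Fin.le_def] at hja
        refine h.symm _ _ _ (hcast (h.rel_of_between (hx j hj b hbJ)
          (hcast (hx j hj a haJ) ?_) (h.symm _ _ _ hz') (h.symm _ _ _ hz)) ?_) <;>
          simp only [Nat.dist] <;> omega
    · push Not at hup
      -- Everything present lies below `i`. Exact distance from the lowest index `b` forces, by
      -- `rel_of_beyond`, the relation to every index between `b` and `a`.
      obtain ⟨b, ⟨hbJ, hbi⟩, hb⟩ := Set.exists_min_image {j | j ∈ J ∧ j < i} id (Set.toFinite _) hlo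
      have hba := ha b ⟨hbJ, hbi⟩
      simp only [id, Fin.le_def] at hba
      have := h.exists_prolongation (s := i - a) (hx b hbJ a haJ) (by omega)
        (by simp only [Nat.dist]; omega)
      refine this.trans (Set.encard_le_encard ?_)
      rintro z ⟨hz, hz'⟩ j hj
      have hji := lt_of_le_of_ne (hup j hj) (hne j hj)
      have h1 := ha j ⟨hj, hji⟩
      have h2 := hb j ⟨hj, hji⟩
      simp only [id, Fin.le_def] at h1 h2
      refine h.symm _ _ _ (hcast (h.rel_of_beyond (hx b hbJ j hj) (hx j hj a haJ) hz ?_) ?_)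
      · rw [hz']; simp only [Nat.dist]; congr 1; omega
      · simp only [Nat.dist]; omega
  · by_cases hup : ∃ j ∈ J, i < j
    · obtain ⟨a, ⟨haJ, hai⟩, ha⟩ := Set.exists_max_image {j | j ∈ J ∧ i < j} id (Set.toFinite _) hup
      obtain ⟨b, ⟨hbJ, hbi⟩, hb⟩ := Set.exists_min_image {j | j ∈ J ∧ i < j} id (Set.toFinite _) hup
      have hba := ha b ⟨hbJ, hbi⟩
      simp only [id, Fin.le_def] at hba
      push Not at hlo
      have := h.exists_prolongation (s := b - i) (hx a haJ b hbJ) (by omega)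
        (by simp only [Nat.dist]; omega)
      refine this.trans (Set.encard_le_encard ?_)
      rintro z ⟨hz, hz'⟩ j hj
      have hji := lt_of_le_of_ne (hlo j hj) (hne j hj).symm
      have h1 := ha j ⟨hj, hji⟩
      have h2 := hb j ⟨hj, hji⟩
      simp only [id, Fin.le_def] at h1 h2
      refine h.symm _ _ _ (hcast (h.rel_of_beyond (hx a haJ j hj) (hx j hj b hbJ) hz ?_) ?_)
      · rw [hz']; simp only [Nat.dist]; congr 1; omega
      · simp only [Nat.dist]; omega
    · have hJ : ∀ j, j ∉ J := by
        intro j hj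
        rcases lt_or_gt_of_ne (hne j hj) with hji | hji
        · exact hlo ⟨j, hj, hji⟩
        · exact hup ⟨j, hj, hji⟩
      obtain ⟨y⟩ := ‹Nonempty Ω›
      -- For empty `J` there is no constraint, but `Ω` must still have three points; a unit
      -- prolongation of a trivial geodesic supplies them, which uses `1 < K`.
      have := h.exists_prolongation (s := 1) ((h.zero y y).2 rfl) one_pos (by omega)
      refine this.trans (Set.encard_le_encard ?_)
      intro z _ j hj
      exact absurd hj (hJ j)

omit h in
/-- Geodesics of a geodesic system form a uniform geometry for any primitive group that is
transitive on them. -/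
theorem exists_isUniform {Ω : Type} {K w : ℕ} {d : Ω → Ω → ℕ} {D : ℕ → Ω → Ω → Prop}
    (h : IsGeodesicSystem K w d D) {k : ℕ} (hk : k < K) (hK : 1 < K) [Nonempty Ω] [Finite Ω]
    (G : Type) [Group G] [MulAction G Ω] [IsPreprimitive G Ω]
    (hinv : ∀ (g : G) n x y, D n x y → D n (g • x) (g • y))
    (htrans : ∀ x y : ℕ → Ω, (∀ i j, i ≤ j → j < k → D (j - i) (x i) (x j)) →
      (∀ i j, i ≤ j → j < k → D (j - i) (y i) (y j)) → ∃ g : G, ∀ i < k, g • x i = y i) :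
    ∃ (X : Type) (_ : Finite X) (_ : MulAction G X) (Γ : Pregeometry X (Fin k)),
      Γ.IsUniform G Ω := by
  classical
  refine ⟨Σ _ : Fin k, Ω, inferInstance, inferInstance,
    Pregeometry.ofRelations (fun i j x y => D (Nat.dist i j) x y)
      (fun i x y => by simp only [Nat.dist_self, h.zero])
      (fun i j x y hxy => by rw [Nat.dist_comm]; exact h.symm _ _ _ hxy), ?_⟩
  refine Pregeometry.isUniform_ofRelations
    (h.three_le_encard_extension hk hK) (fun g i j x y => hinv g _ x y) fun x y hx hy => ?_
  have key : ∀ x : Fin k → Ω, (∀ i j : Fin k, D (Nat.dist i j) (x i) (x j)) → ∀ i j, i ≤ j →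
      j < k → D (j - i) (if hi : i < k then x ⟨i, hi⟩ else Classical.arbitrary Ω)
        (if hj : j < k then x ⟨j, hj⟩ else Classical.arbitrary Ω) := by
    intro x hx i j hij hj
    have hi : i < k := by omega
    rw [dif_pos hi, dif_pos hj]
    simpa [Nat.dist, Nat.sub_eq_zero_of_le hij] using hx ⟨i, hi⟩ ⟨j, hj⟩
  obtain ⟨g, hg⟩ := htrans (fun i => if hi : i < k then x ⟨i, hi⟩ else Classical.arbitrary Ω)
    (fun i => if hi : i < k then y ⟨i, hi⟩ else Classical.arbitrary Ω) (key x hx) (key y hy)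
  exact ⟨g, fun i => by simpa using hg i i.2⟩

end IsGeodesicSystem

/-! ### Counting lemmas -/

theorem Nat.le_choose {n m : ℕ} (hm : 0 < m) (hmn : m < n) : n ≤ n.choose m := by
  induction n generalizing m with
  | zero => omega
  | succ n ih =>
    obtain ⟨m, rfl⟩ : ∃ l, m = l + 1 := ⟨m - 1, by omega⟩
    rw [Nat.choose_succ_succ]
    rcases eq_or_lt_of_le (show m + 1 ≤ n by omega) with h | h
    · subst h
      simp
    · have := ih (Nat.succ_pos m) h
      have := Nat.choose_pos (show m ≤ n by omega)
      simp only [Nat.succ_eq_add_one] at *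
      omega

/-- Midpoints correspond to the choice of which `2 * s` of the `2 * (s + t)` elementary changes come
first. There are at least `2 * (s + t) ≥ 4` choices; without the factor 2 the case `s = t = 1` would
give only two. -/
theorem three_le_encard_of_powersetCard {α β : Type*} [DecidableEq α] {S : Finset α} {s t : ℕ}
    (hs : 0 < s) (ht : 0 < t) (hS : S.card = 2 * (s + t)) {f : Finset α → β} {Z : Set β}
    (hf : ∀ A ⊆ S, A.card = 2 * s → f A ∈ Z)
    (hinj : ∀ A ⊆ S, ∀ B ⊆ S, f A = f B → A = B) : 3 ≤ Z.encard := by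
  have hinj' : Set.InjOn f (S.powersetCard (2 * s) : Set (Finset α)) := by
    intro A hA B hB h
    rw [Finset.mem_coe, Finset.mem_powersetCard] at hA hB
    exact hinj A hA.1 B hB.1 h
  refine le_trans ?_ (Set.encard_le_encard (s := f '' (S.powersetCard (2 * s) : Set _)) ?_)
  · rw [hinj'.encard_image, Set.encard_coe_eq_coe_finsetCard, Finset.card_powersetCard, hS]
    have := Nat.le_choose (show 0 < 2 * s by omega) (show 2 * s < 2 * (s + t) by omega)
    exact_mod_cast (show 3 ≤ 2 * (s + t) by omega).trans this
  · rintro _ ⟨A, hA, rfl⟩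
    rw [Finset.mem_coe, Finset.mem_powersetCard] at hA
    exact hf A hA.1 hA.2

/-- Cumulative counts determine the fibre sizes of `l` and `l'` by subtraction, and functions with
equal fibre sizes differ by a permutation. -/
theorem exists_perm_of_card_filter_le {ι : Type*} [Fintype ι] (l l' : ι → ℕ)
    (h : ∀ i, (Finset.univ.filter fun c => l c ≤ i).card =
      (Finset.univ.filter fun c => l' c ≤ i).card) :
    ∃ σ : Equiv.Perm ι, ∀ c, l' (σ c) = l c := by
  classical
  have hsplit : ∀ (l : ι → ℕ) i, (Finset.univ.filter fun c => l c ≤ i + 1).card =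
      (Finset.univ.filter fun c => l c ≤ i).card +
        (Finset.univ.filter fun c => l c = i + 1).card := by
    intro l i
    rw [← Finset.card_union_of_disjoint]
    · congr 1
      ext c
      simp only [Finset.mem_filter, Finset.mem_univ, true_and, Finset.mem_union]
      omega
    · rw [Finset.disjoint_filter]
      intro c _ h1 h2
      omega
  have hfib : ∀ i, Fintype.card {c // l c = i} = Fintype.card {c // l' c = i} := by
    intro i
    rw [Fintype.card_subtype, Fintype.card_subtype]
    cases i with
    | zero => simpa using h 0
    | succ i =>
      have h1 := hsplit l i
      have h2 := hsplit l' i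
      have := h i
      have := h (i + 1)
      omega
  exact ⟨Equiv.ofFiberEquiv fun i => Fintype.equivOfCardEq (hfib i),
    fun c => Equiv.ofFiberEquiv_map _ c⟩

/-! ### Wreath products in product action -/

/-- The wreath product of `H` with the full symmetric group on `ι`. -/
@[ext]
structure WreathProduct (H ι : Type*) where
  base : ι → H
  perm : Equiv.Perm ι

theorem faithfulSMul_of_eq_one {G Ω : Type*} [Group G] [MulAction G Ω]
    (h : ∀ g : G, (∀ x : Ω, g • x = x) → g = 1) : FaithfulSMul G Ω := by
  refine ⟨fun {g g'} hg => ?_⟩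
  rw [← inv_mul_eq_one]
  refine h _ fun x => ?_
  rw [mul_smul, ← hg x, inv_smul_smul]

theorem Subgroup.exists_mem_ne_one {G : Type*} [Group G] {K : Subgroup G} (hK : K ≠ ⊥) :
    ∃ g ∈ K, g ≠ 1 := by
  by_contra h
  push Not at h
  exact hK ((Subgroup.eq_bot_iff_forall K).2 h)

namespace WreathProduct

variable {H ι Δ : Type*} [Group H]

instance : Mul (WreathProduct H ι) :=
  ⟨fun g h => ⟨fun i => g.base i * h.base (g.perm.symm i), g.perm * h.perm⟩⟩

instance : One (WreathProduct H ι) := ⟨⟨1, 1⟩⟩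

instance : Inv (WreathProduct H ι) := ⟨fun g => ⟨fun i => (g.base (g.perm i))⁻¹, g.perm⁻¹⟩⟩

@[simp] theorem mul_base (g h : WreathProduct H ι) (i : ι) :
    (g * h).base i = g.base i * h.base (g.perm.symm i) := rfl

@[simp] theorem mul_perm (g h : WreathProduct H ι) : (g * h).perm = g.perm * h.perm := rfl

@[simp] theorem one_base (i : ι) : (1 : WreathProduct H ι).base i = 1 := rfl

@[simp] theorem one_perm : (1 : WreathProduct H ι).perm = 1 := rfl

@[simp] theorem inv_base (g : WreathProduct H ι) (i : ι) :
    (g⁻¹).base i = (g.base (g.perm i))⁻¹ := rfl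

@[simp] theorem inv_perm (g : WreathProduct H ι) : (g⁻¹).perm = g.perm⁻¹ := rfl

instance : Group (WreathProduct H ι) :=
  Group.ofLeftAxioms
    (fun a b c => by
      ext i
      · simp only [mul_base, mul_perm, mul_assoc]
        rfl
      · rfl)
    (fun a => by
      ext i
      · simp only [mul_base, one_base, one_perm, one_mul]
        rfl
      · rfl)
    (fun a => by
      ext i
      · simp only [mul_base, inv_base, inv_perm, one_base]
        exact inv_mul_cancel _
      · simp)

@[simp] theorem symm_one_apply (i : ι) : (Equiv.symm (1 : Equiv.Perm ι)) i = i := rfl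

instance [MulAction H Δ] : MulAction (WreathProduct H ι) (ι → Δ) where
  smul g x i := g.base i • x (g.perm.symm i)
  one_smul x := by
    funext i
    exact one_smul H (x i)
  mul_smul g h x := by
    funext i
    exact mul_smul _ _ _

theorem smul_apply [MulAction H Δ] (g : WreathProduct H ι) (x : ι → Δ) (i : ι) :
    (g • x) i = g.base i • x (g.perm.symm i) := rfl

/-- The element of the base group with a single nontrivial coordinate. -/
def single [DecidableEq ι] (i : ι) (h : H) : WreathProduct H ι := ⟨Pi.mulSingle i h, 1⟩

/-- The element of the top group given by a permutation. -/
def ofPerm (σ : Equiv.Perm ι) : WreathProduct H ι := ⟨1, σ⟩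

section single

variable [DecidableEq ι]

theorem single_mul (i : ι) (h h' : H) :
    single i (h * h') = (single i h * single i h' : WreathProduct H ι) := by
  ext j
  · simp only [single, Pi.mulSingle_mul]
    rfl
  · rfl

theorem single_inv (i : ι) (h : H) : single i h⁻¹ = (single i h : WreathProduct H ι)⁻¹ := by
  rw [eq_inv_iff_mul_eq_one, ← single_mul, inv_mul_cancel]
  ext j
  · simp [single]
  · rfl

theorem ofPerm_mul_single_mul_inv (σ : Equiv.Perm ι) (i : ι) (h : H) :
    ofPerm σ * single i h * (ofPerm σ)⁻¹ = single (σ i) h := by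
  ext j
  · by_cases hj : j = σ i
    · subst hj
      simp [ofPerm, single]
    · have : σ.symm j ≠ i := fun h => hj (by rw [← h, Equiv.apply_symm_apply])
      simp [ofPerm, single, Pi.mulSingle_eq_of_ne hj, Pi.mulSingle_eq_of_ne this]
  · simp [ofPerm, single]

theorem single_smul [MulAction H Δ] (i : ι) (h : H) (x : ι → Δ) :
    single i h • x = Function.update x i (h • x i) := by
  funext j
  rw [smul_apply]
  by_cases hj : j = i
  · subst hj
    simp [single]
  · simp [single, Pi.mulSingle_eq_of_ne hj, Function.update_of_ne hj]

end single

theorem ofPerm_smul_const [MulAction H Δ] (σ : Equiv.Perm ι) (a : Δ) :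
    (ofPerm σ : WreathProduct H ι) • (fun _ : ι => a) = fun _ => a := by
  funext i
  simp [smul_apply, ofPerm]

instance [MulAction H Δ] [IsPretransitive H Δ] :
    IsPretransitive (WreathProduct H ι) (ι → Δ) := by
  refine ⟨fun x y => ?_⟩
  choose h hh using fun i => exists_smul_eq H (x i) (y i)
  exact ⟨⟨h, 1⟩, funext hh⟩

instance [MulAction H Δ] [FaithfulSMul H Δ] [Nontrivial Δ] :
    FaithfulSMul (WreathProduct H ι) (ι → Δ) := by
  classical
  refine faithfulSMul_of_eq_one fun g hg => ?_
  have hperm : ∀ i, g.perm.symm i = i := by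
    intro i
    by_contra hne
    obtain ⟨a, b, hab⟩ := exists_pair_ne Δ
    have h1 := congrFun (hg fun _ => a) i
    have h2 := congrFun (hg (Function.update (fun _ => a) i b)) i
    rw [smul_apply] at h1 h2
    rw [Function.update_of_ne hne, Function.update_self, h1] at h2
    exact hab h2
  ext i
  · refine FaithfulSMul.eq_of_smul_eq_smul (α := Δ) fun a => ?_
    rw [one_base, one_smul]
    exact congrFun (hg fun _ => a) i
  · rw [one_perm, Equiv.Perm.one_apply]
    have := hperm i
    rw [Equiv.symm_apply_eq] at this
    exact this.symm

/-- A wreath product in product action is primitive when the factor is primitive and the point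
stabilisers of the factor fix no further point. -/
theorem isPreprimitive [Finite ι] [MulAction H Δ] [IsPreprimitive H Δ]
    (hmoves : ∀ a b : Δ, a ≠ b → ∃ h : H, h • a = a ∧ h • b ≠ b) :
    IsPreprimitive (WreathProduct H ι) (ι → Δ) := by
  classical
  cases nonempty_fintype ι
  rcases isEmpty_or_nonempty Δ with hΔ | ⟨⟨a⟩⟩
  · rcases isEmpty_or_nonempty ι with hι | hι
    · exact IsPreprimitive.of_subsingleton
    · have : IsEmpty (ι → Δ) := isEmpty_fun.2 ⟨hι, hΔ⟩
      exact IsPreprimitive.of_subsingleton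
  refine IsPreprimitive.of_isTrivialBlock_base (fun _ => a) fun {B} haB hB => ?_
  refine or_iff_not_imp_left.2 fun hns => ?_
  obtain ⟨β, hβ, hne⟩ : ∃ β ∈ B, β ≠ fun _ => a := by
    by_contra hcon
    push Not at hcon
    exact hns fun x hx y hy => (hcon x hx).trans (hcon y hy).symm
  obtain ⟨i, hi⟩ := Function.ne_iff.1 hne
  have hstab : ∀ {g : WreathProduct H ι} {x}, x ∈ B → g • x ∈ B → ∀ y ∈ B, g • y ∈ B := by
    intro g x hx hgx y hy
    have : g • B = B := hB.smul_eq_of_mem hx hgx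
    rw [← this]
    exact Set.smul_mem_smul_set hy
  -- An element of `H` fixing `a` and moving `β i`, put in coordinate `i`, fixes the base point and
  -- so stabilises `B`. Thus `B` contains two points differing in coordinate `i` only.
  obtain ⟨h, hha, hhb⟩ := hmoves a (β i) (Ne.symm hi)
  have h1 : Function.update β i (h • β i) ∈ B := by
    rw [← single_smul]
    refine hstab haB ?_ β hβ
    rw [single_smul, hha]
    simpa using haB
  -- The slice of `B` along coordinate `i` through `β` is a block of `H` with two points, hence
  -- everything.
  have hC : IsBlock H {δ | Function.update β i δ ∈ B} := by
    rw [isBlock_iff_smul_eq_or_disjoint]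
    intro g
    have hg : ∀ δ, δ ∈ g • {δ | Function.update β i δ ∈ B} ↔
        Function.update β i δ ∈ (single i g : WreathProduct H ι) • B := by
      intro δ
      rw [Set.mem_smul_set_iff_inv_smul_mem, Set.mem_smul_set_iff_inv_smul_mem, ← single_inv,
        single_smul]
      simp
    rcases isBlock_iff_smul_eq_or_disjoint.1 hB (single i g) with h | h
    · left
      ext δ
      rw [hg, h]
      rfl
    · right
      rw [Set.disjoint_left] at h ⊢
      intro δ hδ hδ'
      exact h ((hg δ).1 hδ) hδ'
  have hall : ∀ δ, Function.update β i δ ∈ B := by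
    rcases IsPreprimitive.isTrivialBlock_of_isBlock hC with hs | hs
    · exact absurd (hs (show Function.update β i (h • β i) ∈ B from h1)
        (show Function.update β i (β i) ∈ B by simpa using hβ)) hhb
    · intro δ
      exact hs.symm.subset (Set.mem_univ δ)
  have hsi : ∀ (g : H), ∀ y ∈ B, (single i g : WreathProduct H ι) • y ∈ B := by
    intro g
    exact hstab hβ (by rw [single_smul]; exact hall _)
  have hsj : ∀ j (g : H), ∀ y ∈ B, (single j g : WreathProduct H ι) • y ∈ B := by
    intro j g y hy
    -- Permutations of coordinates fix the constant base point and so preserve `B`; conjugating by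
    -- them carries coordinate `i` to any other.
    have hp : ∀ σ : Equiv.Perm ι, ∀ y ∈ B, (ofPerm σ : WreathProduct H ι) • y ∈ B := fun σ =>
      hstab haB (by rw [ofPerm_smul_const]; exact haB)
    have hpi : (ofPerm (Equiv.swap i j) : WreathProduct H ι)⁻¹ = ofPerm (Equiv.swap i j)⁻¹ := by
      ext l
      · simp [ofPerm]
      · simp [ofPerm]
    have := hp (Equiv.swap i j) _ (hsi g _ (hp (Equiv.swap i j)⁻¹ y hy))
    rwa [← hpi, ← mul_smul, ← mul_smul, ofPerm_mul_single_mul_inv,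
      Equiv.swap_apply_left] at this
  have hfin : ∀ (S : Finset ι) (γ : ι → Δ), (∀ j ∉ S, γ j = a) → γ ∈ B := by
    intro S
    induction S using Finset.induction_on with
    | empty =>
      intro γ hγ
      obtain rfl : γ = fun _ => a := funext fun j => hγ j (by simp)
      exact haB
    | insert j S _ ih =>
      intro γ hγ
      obtain ⟨g, hg⟩ := exists_smul_eq H a (γ j)
      have := hsj j g _ (ih (Function.update γ j a) fun l hl => by
        by_cases hlj : l = j
        · subst hlj
          simp
        · rw [Function.update_of_ne hlj]
          exact hγ l (by simp [hl, hlj]))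
      rw [single_smul] at this
      simpa [hg] using this
  exact Set.eq_univ_of_forall fun γ => hfin Finset.univ γ (by simp)

/-- The subgroup of the base group with all coordinates in `L`. -/
def baseSubgroup (ι : Type*) (L : Subgroup H) : Subgroup (WreathProduct H ι) where
  carrier := {g | g.perm = 1 ∧ ∀ i, g.base i ∈ L}
  one_mem' := ⟨rfl, fun _ => L.one_mem⟩
  mul_mem' := by
    rintro g h ⟨hg, hg'⟩ ⟨hh, hh'⟩
    exact ⟨by simp [hg, hh], fun i => L.mul_mem (hg' _) (hh' _)⟩
  inv_mem' := by
    rintro g ⟨hg, hg'⟩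
    exact ⟨by simp [hg], fun i => L.inv_mem (hg' _)⟩

theorem single_mem_baseSubgroup [DecidableEq ι] {L : Subgroup H} (i : ι) {h : H} (hh : h ∈ L) :
    single i h ∈ baseSubgroup ι L := by
  refine ⟨rfl, fun j => ?_⟩
  by_cases hj : j = i
  · subst hj
    simpa [single] using hh
  · simp [single, Pi.mulSingle_eq_of_ne hj]

theorem baseSubgroup_normal {L : Subgroup H} (hL : L.Normal) : (baseSubgroup ι L).Normal := by
  refine ⟨fun g hg w => ⟨by simp [hg.1], fun i => ?_⟩⟩
  have := hL.conj_mem _ (hg.2 (w.perm.symm i)) (w.base i)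
  simpa [hg.1] using this

theorem baseSubgroup_ne_bot [Nonempty ι] {L : Subgroup H} (hL : L ≠ ⊥) :
    baseSubgroup ι L ≠ ⊥ := by
  classical
  obtain ⟨h, hh, hne⟩ := Subgroup.exists_mem_ne_one hL
  obtain ⟨i⟩ := ‹Nonempty ι›
  intro hbot
  have := single_mem_baseSubgroup i hh
  rw [hbot, Subgroup.mem_bot] at this
  exact hne (by simpa [single] using congrArg (fun g => g.base i) this)

theorem baseSubgroup_mono {L M : Subgroup H} (h : L ≤ M) : baseSubgroup ι L ≤ baseSubgroup ι M :=
  fun _ hg => ⟨hg.1, fun i => h (hg.2 i)⟩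

theorem baseSubgroup_le_iff [Nonempty ι] {L M : Subgroup H} :
    baseSubgroup ι L ≤ baseSubgroup ι M ↔ L ≤ M := by
  classical
  refine ⟨fun h x hx => ?_, baseSubgroup_mono⟩
  obtain ⟨i⟩ := ‹Nonempty ι›
  simpa [single] using (h (single_mem_baseSubgroup i hx)).2 i

/-- The base subgroup over `L` is a direct power of `L`. -/
def baseSubgroupEquiv (ι : Type*) (L : Subgroup H) : baseSubgroup ι L ≃* (ι → L) where
  toFun g i := ⟨g.1.base i, g.2.2 i⟩
  invFun f := ⟨⟨fun i => f i, 1⟩, rfl, fun i => (f i).2⟩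
  left_inv := by
    rintro ⟨g, hg, hg'⟩
    exact Subtype.ext (WreathProduct.ext rfl hg.symm)
  right_inv f := rfl
  map_mul' := by
    rintro ⟨g, hg, hg'⟩ ⟨h, hh, hh'⟩
    funext i
    apply Subtype.ext
    simp [hg]

/-- Point stabilisers in the base subgroup over `L` are products of point stabilisers in `L`. -/
def stabilizerBaseSubgroupEquiv [MulAction H Δ] (L : Subgroup H) (α : ι → Δ) :
    stabilizer (baseSubgroup ι L) α ≃* (∀ i, stabilizer L (α i)) where
  toFun g i := ⟨⟨g.1.1.base i, g.1.2.2 i⟩, by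
    have := congrFun g.2 i
    rw [Subgroup.smul_def, smul_apply, g.1.2.1] at this
    exact this⟩
  invFun f := ⟨⟨⟨fun i => (f i).1, 1⟩, rfl, fun i => (f i).1.2⟩, funext fun i => (f i).2⟩
  left_inv := by
    rintro ⟨⟨g, hg, hg'⟩, hs⟩
    exact Subtype.ext (Subtype.ext (WreathProduct.ext rfl hg.symm))
  right_inv f := rfl
  map_mul' := by
    rintro ⟨⟨g, hg, hg'⟩, hs⟩ ⟨⟨h, hh, hh'⟩, hs'⟩
    funext i
    apply Subtype.ext
    apply Subtype.ext
    simp [hg]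

/-- Two commutators with single-coordinate elements push a nontrivial element of `K` into one
coordinate: the first removes a nontrivial permutation, the second isolates a coordinate that is not
central in `H`. The elements of `H` whose copy in that coordinate lies in `K` form `L`, and
permutations spread `L` over all coordinates. -/
theorem exists_baseSubgroup_le [Nonempty ι] [Nontrivial H]
    (hZ : ∀ z : H, (∀ h, h * z = z * h) → z = 1)
    {K : Subgroup (WreathProduct H ι)} (hK : K.Normal) (hne : K ≠ ⊥) [Finite ι] :
    ∃ L : Subgroup H, L.Normal ∧ L ≠ ⊥ ∧ baseSubgroup ι L ≤ K := by
  classical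
  cases nonempty_fintype ι
  have hcomm : ∀ g ∈ K, ∀ w, g * w * g⁻¹ * w⁻¹ ∈ K := by
    intro g hg w
    have := K.mul_mem hg (hK.conj_mem _ (K.inv_mem hg) w)
    simpa [mul_assoc] using this
  obtain ⟨g, hgK, hg⟩ := Subgroup.exists_mem_ne_one hne
  have hbase : ∃ f ∈ K, f.perm = 1 ∧ f ≠ 1 := by
    by_cases hp : g.perm = 1
    · exact ⟨g, hgK, hp, hg⟩
    · obtain ⟨i, hi⟩ : ∃ i, g.perm i ≠ i := by
        by_contra hcon
        push Not at hcon
        exact hp (Equiv.ext hcon)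
      obtain ⟨h, hh⟩ := exists_ne (1 : H)
      refine ⟨_, hcomm g hgK (single i h), by simp [single], fun h1 => hh ?_⟩
      have := congrArg (fun w => w.base i) h1
      have hi' : g.perm.symm i ≠ i := fun h => hi (by rw [Equiv.symm_apply_eq] at h; exact h.symm)
      simpa [single, Pi.mulSingle_eq_of_ne hi'] using this
  obtain ⟨f, hfK, hfp, hf⟩ := hbase
  obtain ⟨i, hi⟩ : ∃ i, f.base i ≠ 1 := by
    by_contra hcon
    push Not at hcon
    exact hf (WreathProduct.ext (funext hcon) hfp)
  obtain ⟨h, hh⟩ : ∃ h, h * f.base i ≠ f.base i * h := by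
    by_contra hcon
    push Not at hcon
    exact hi (hZ _ hcon)
  have hsymm : ∀ j, f.perm.symm j = j := fun j => by rw [hfp, symm_one_apply]
  have hcs : f * single i h * f⁻¹ * (single i h)⁻¹ =
      single i (f.base i * h * (f.base i)⁻¹ * h⁻¹) := by
    ext j
    · by_cases hj : j = i
      · subst hj
        simp [single, hfp]
        rw [hsymm, Pi.mulSingle_eq_same]
      · simp [single, hfp, Pi.mulSingle_eq_of_ne hj]
        rw [hsymm, Pi.mulSingle_eq_of_ne hj]
    · simp [single, hfp]
  let L : Subgroup H :=
    { carrier := {x | single i x ∈ K}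
      one_mem' := by
        have : (single i 1 : WreathProduct H ι) = 1 := by
          ext j
          · simp [single]
          · rfl
        simpa only [Set.mem_ofPred_eq, this] using K.one_mem
      mul_mem' := fun hx hy => by
        simpa only [Set.mem_ofPred_eq, single_mul] using K.mul_mem hx hy
      inv_mem' := fun hx => by
        simpa only [Set.mem_ofPred_eq, single_inv] using K.inv_mem hx }
  refine ⟨L, ⟨fun x hx y => ?_⟩, fun hbot => ?_, ?_⟩
  · have := hK.conj_mem _ hx (single i y)
    rwa [← single_mul, ← single_inv, ← single_mul] at this
  · have : f.base i * h * (f.base i)⁻¹ * h⁻¹ ∈ L := by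
      change single i _ ∈ K
      rw [← hcs]
      exact hcomm f hfK _
    rw [hbot, Subgroup.mem_bot, mul_inv_eq_one, mul_inv_eq_iff_eq_mul] at this
    exact hh this.symm
  · have hj : ∀ j, ∀ x ∈ L, single j x ∈ K := by
      intro j x hx
      have := hK.conj_mem _ hx (ofPerm (Equiv.swap i j))
      rwa [ofPerm_mul_single_mul_inv, Equiv.swap_apply_left] at this
    have key : ∀ (S : Finset ι) (w : WreathProduct H ι), w ∈ baseSubgroup ι L →
        (∀ j ∉ S, w.base j = 1) → w ∈ K := by
      intro S
      induction S using Finset.induction_on with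
      | empty =>
        intro w hw hS
        obtain rfl : w = 1 := WreathProduct.ext (funext fun j => hS j (by simp)) hw.1
        exact K.one_mem
      | insert j S hjS ih =>
        intro w hw hS
        have h1 := K.mul_mem (hj j _ (hw.2 j)) (ih ((single j (w.base j))⁻¹ * w)
          ((baseSubgroup ι L).mul_mem ((baseSubgroup ι L).inv_mem
            (single_mem_baseSubgroup j (hw.2 j))) hw) fun l hl => by
              by_cases hlj : l = j
              · subst hlj
                simp [single]
              · have := hS l (by simp [hl, hlj])
                simp [single, Pi.mulSingle_eq_of_ne hlj, this])
        simpa using h1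
    exact fun w hw => key Finset.univ w hw (by simp)

end WreathProduct

/-- A primitive action suitable as the factor of a product action: faithful, point stabilisers fix
no further point, and some pair of points can be swapped. -/
structure IsProductFactor (H Δ : Type*) [Group H] [MulAction H Δ] : Prop where
  finite : Finite Δ
  faithful : FaithfulSMul H Δ
  primitive : IsPreprimitive H Δ
  moves : ∀ a b : Δ, a ≠ b → ∃ h : H, h • a = a ∧ h • b ≠ b
  swaps : ∃ a b : Δ, a ≠ b ∧ ∃ h : H, h • a = b ∧ h • b = a

theorem moves_of_base {H Δ : Type*} [Group H] [MulAction H Δ] [IsPretransitive H Δ] (a : Δ)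
    (h : ∀ b, b ≠ a → ∃ h : H, h • a = a ∧ h • b ≠ b) (c d : Δ) (hcd : c ≠ d) :
    ∃ h : H, h • c = c ∧ h • d ≠ d := by
  obtain ⟨g, rfl⟩ := exists_smul_eq H a c
  obtain ⟨k, hk, hk'⟩ := h (g⁻¹ • d) (fun h => hcd (by rw [← h, smul_inv_smul]))
  refine ⟨g * k * g⁻¹, by simp [mul_smul, hk], fun h => hk' ?_⟩
  rw [eq_inv_smul_iff]
  simpa [mul_smul] using h

namespace IsProductFactor

variable {H Δ : Type*} [Group H] [MulAction H Δ]

theorem nontrivial (hH : IsProductFactor H Δ) : Nontrivial Δ := by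
  obtain ⟨a, b, hab, -⟩ := hH.swaps
  exact ⟨a, b, hab⟩

theorem nontrivial_group (hH : IsProductFactor H Δ) : Nontrivial H := by
  obtain ⟨a, b, hab, h, ha, -⟩ := hH.swaps
  exact ⟨h, 1, fun h1 => hab (by rw [← ha, h1, one_smul])⟩

/-- The stabiliser of `a` would also fix `z • a`, against `moves`. -/
theorem eq_one_of_central (hH : IsProductFactor H Δ) (z : H) (hz : ∀ h, h * z = z * h) :
    z = 1 := by
  have := hH.faithful
  refine FaithfulSMul.eq_of_smul_eq_smul (α := Δ) fun a => ?_
  rw [one_smul]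
  by_contra hne
  obtain ⟨h, ha, hb⟩ := hH.moves a (z • a) (Ne.symm hne)
  exact hb (by rw [← mul_smul, hz, mul_smul, ha])

/-- The orbital of a swappable pair is self-paired, which is what makes `R` symmetric. -/
theorem exists_orbital (hH : IsProductFactor H Δ) :
    ∃ R : Δ → Δ → Prop, (∀ a b, R a b → R b a) ∧ (∀ a, ¬ R a a) ∧
      (∀ (h : H) a b, R a b → R (h • a) (h • b)) ∧ (∀ a, ∃ b, R a b) ∧
      ∀ a b a' b', R a b → R a' b' → ∃ h : H, h • a = a' ∧ h • b = b' := by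
  obtain ⟨a, b, hab, s, hsa, hsb⟩ := hH.swaps
  have := hH.primitive
  refine ⟨fun x y => ∃ h : H, h • a = x ∧ h • b = y, ?_, ?_, ?_, ?_, ?_⟩
  · rintro _ _ ⟨h, rfl, rfl⟩
    exact ⟨h * s, by rw [mul_smul, hsa], by rw [mul_smul, hsb]⟩
  · rintro x ⟨h, h1, h2⟩
    exact hab (smul_left_cancel h (h1.trans h2.symm))
  · rintro g _ _ ⟨h, rfl, rfl⟩
    exact ⟨g * h, mul_smul _ _ _, mul_smul _ _ _⟩
  · intro x
    obtain ⟨h, rfl⟩ := exists_smul_eq H a x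
    exact ⟨h • b, h, rfl, rfl⟩
  · rintro _ _ _ _ ⟨g, rfl, rfl⟩ ⟨h, rfl, rfl⟩
    exact ⟨h * g⁻¹, by simp [mul_smul], by simp [mul_smul]⟩

end IsProductFactor

/-! ### Geodesics in the Hamming metric -/

section Hamming

variable {ι Δ : Type*} [Fintype ι] [DecidableEq Δ]

/-- The coordinates where `x, z` differ lie in the union of those where `x, y` and `y, z` differ;
equality in the triangle inequality leaves no room for an overlap. -/
theorem eq_or_eq_of_hammingDist_add {x y z : ι → Δ}
    (h : hammingDist x y + hammingDist y z = hammingDist x z) (c : ι) :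
    x c = y c ∨ y c = z c := by
  classical
  by_contra hcon
  push Not at hcon
  have h1 : (Finset.univ.filter fun c => x c ≠ z c) ⊆
      (Finset.univ.filter fun c => x c ≠ y c) ∪ (Finset.univ.filter fun c => y c ≠ z c) := by
    intro c
    simp only [Finset.mem_filter, Finset.mem_univ, true_and, Finset.mem_union]
    intro hxz
    by_contra h
    push Not at h
    exact hxz (h.1.trans h.2)
  have h2 := Finset.card_le_card h1
  have h3 := Finset.card_union_add_card_inter (Finset.univ.filter fun c => x c ≠ y c)
    (Finset.univ.filter fun c => y c ≠ z c)
  have h4 : 0 < ((Finset.univ.filter fun c => x c ≠ y c) ∩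
      (Finset.univ.filter fun c => y c ≠ z c)).card :=
    Finset.card_pos.2 ⟨c, by simpa using hcon⟩
  simp only [hammingDist] at h
  omega

/-- Two points are related at distance `n` if they differ in exactly `2 * n` coordinates, and there
by pairs in `R`. -/
def productDist (R : Δ → Δ → Prop) (n : ℕ) (x y : ι → Δ) : Prop :=
  hammingDist x y = 2 * n ∧ ∀ c, x c ≠ y c → R (x c) (y c)

theorem isGeodesicSystem_productDist {R : Δ → Δ → Prop} (hsymm : ∀ a b, R a b → R b a)
    (hirr : ∀ a, ¬ R a a) (hex : ∀ a, ∃ b, R a b) {K : ℕ} (hK : 2 * K ≤ Fintype.card ι) :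
    IsGeodesicSystem K 2 (hammingDist (ι := ι) (β := fun _ => Δ)) (productDist R) where
  zero x y := by
    constructor
    · intro h
      exact hammingDist_eq_zero.1 h.1
    · rintro rfl
      exact ⟨by simp, fun c hc => absurd rfl hc⟩
  symm n x y h := ⟨by rw [hammingDist_comm]; exact h.1, fun c hc => hsymm _ _ (h.2 c hc.symm)⟩
  dist_eq n x y h := h.1
  triangle := hammingDist_triangle
  comp p q x y z hxy hyz hxz := by
    refine ⟨hxz, fun c hc => ?_⟩
    rcases eq_or_eq_of_hammingDist_add (x := x) (y := y) (z := z)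
      (by rw [hxy.1, hyz.1, hxz]; ring) c with h | h
    · rw [h] at hc ⊢
      exact hyz.2 c hc
    · rw [← h] at hc ⊢
      exact hxy.2 c hc
  interp s t x y hs ht hxy := by
    classical
    refine three_le_encard_of_powersetCard (S := Finset.univ.filter fun c => x c ≠ y c) hs ht hxy.1
      (f := fun A c => if c ∈ A then y c else x c) ?_ ?_
    · intro A hA hAc
      have hA' : ∀ c ∈ A, x c ≠ y c := fun c hc => by simpa using hA hc
      refine ⟨⟨?_, fun c hc => ?_⟩, ?_, fun c hc => ?_⟩
      · rw [← hAc, hammingDist]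
        congr 1
        ext c
        by_cases h : c ∈ A <;> simp [h, hA']
      · by_cases h : c ∈ A
        · simpa [h] using hxy.2 c (hA' c h)
        · simp [h] at hc
      · have : (Finset.univ.filter fun c => (if c ∈ A then y c else x c) ≠ y c) =
            (Finset.univ.filter fun c => x c ≠ y c) \ A := by
          ext c
          by_cases h : c ∈ A <;> simp [h]
        rw [hammingDist, this, Finset.card_sdiff_of_subset hA, hAc]
        have := hxy.1
        rw [hammingDist] at this
        rw [this]
        omega
      · by_cases h : c ∈ A
        · simp [h] at hc
        · simp only [h, if_false] at hc ⊢
          exact hxy.2 c hc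
    -- The set `A` is recovered from the midpoint as the coordinates where it differs from `x`.
    · have key : ∀ A ⊆ Finset.univ.filter fun c => x c ≠ y c,
          A = Finset.univ.filter fun c => x c ≠ if c ∈ A then y c else x c := by
        intro A hA
        have hA' : ∀ c ∈ A, x c ≠ y c := fun c hc => by simpa using hA hc
        ext c
        by_cases h : c ∈ A <;> simp [h, hA']
      intro A hA B hB h
      rw [key A hA, key B hB]
      ext c
      have hc := congrFun h c
      simp only [Finset.mem_filter, Finset.mem_univ, true_and] at hc ⊢
      rw [hc]
  extend n x y hxy hn := by
    classical
    choose b hb using hex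
    have hb' : ∀ a, a ≠ b a := fun a h => hirr a (by simpa [← h] using hb a)
    -- Prolong by changing `2 * (K - n)` coordinates not used yet; the bound `2 * K ≤ Fintype.card
    -- ι` guarantees enough of them.
    obtain ⟨A, hA, hAc⟩ := Finset.exists_subset_card_eq
      (s := (Finset.univ.filter fun c => x c ≠ y c)ᶜ) (n := 2 * (K - n)) (by
        have := hxy.1
        rw [hammingDist] at this
        rw [Finset.card_compl, this]
        omega)
    have hA' : ∀ c ∈ A, x c = y c := fun c hc => by simpa using hA hc
    refine ⟨fun c => if c ∈ A then b (y c) else y c, ⟨?_, fun c hc => ?_⟩, ?_⟩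
    · rw [← hAc, hammingDist]
      congr 1
      ext c
      by_cases h : c ∈ A <;> simp [h, hb']
    · by_cases h : c ∈ A
      · simpa [h] using hb _
      · simp [h] at hc
    · have : (Finset.univ.filter fun c => x c ≠ if c ∈ A then b (y c) else y c) =
          (Finset.univ.filter fun c => x c ≠ y c) ∪ A := by
        ext c
        by_cases h : c ∈ A <;> simp [h, hA', hb']
      rw [hammingDist, this, Finset.card_union_of_disjoint, hAc]
      · have := hxy.1
        rw [hammingDist] at this
        rw [this]
        omega
      · rw [Finset.disjoint_left]
        intro c hc hcA
        exact (by simpa using hc : x c ≠ y c) (hA' c hcA)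

/-- Along a geodesic every coordinate changes at most once. -/
theorem exists_jump {R : Δ → Δ → Prop} (hirr : ∀ a, ¬ R a a) (hex : ∀ a, ∃ b, R a b) {k : ℕ}
    {x : ℕ → ι → Δ} (hx : ∀ i j, i ≤ j → j < k → productDist R (j - i) (x i) (x j)) :
    ∃ (l : ι → ℕ) (b : ι → Δ), (∀ c, l c ≤ k) ∧ (∀ c, R (x 0 c) (b c)) ∧
      (∀ i < k, ∀ c, x i c = if l c ≤ i then b c else x 0 c) ∧
      ∀ i < k, (Finset.univ.filter fun c => l c ≤ i).card = 2 * i := by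
  classical
  have hl : ∀ c, ∃ l b, l ≤ k ∧ R (x 0 c) b ∧ ∀ i < k, x i c = if l ≤ i then b else x 0 c := by
    intro c
    by_cases hc : ∃ i, i < k ∧ x i c ≠ x 0 c
    · refine ⟨Nat.find hc, x (Nat.find hc) c, (Nat.find_spec hc).1.le, ?_, fun i hi => ?_⟩
      · exact (hx 0 _ (Nat.zero_le _) (Nat.find_spec hc).1).2 c (Nat.find_spec hc).2.symm
      · split_ifs with h
        · have h1 := hx 0 _ (Nat.zero_le _) (Nat.find_spec hc).1
          have h2 := hx _ i h hi
          have h3 := hx 0 i (Nat.zero_le _) hi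
          rcases eq_or_eq_of_hammingDist_add (x := x 0) (y := x (Nat.find hc)) (z := x i)
            (by rw [h1.1, h2.1, h3.1]; omega) c with h | h
          · exact absurd h.symm (Nat.find_spec hc).2
          · exact h.symm
        · have := Nat.find_min hc (not_le.1 h)
          push Not at this
          exact this hi
    · push Not at hc
      obtain ⟨b, hb⟩ := hex (x 0 c)
      -- A coordinate that never changes gets jump time `k`, just past the last index, and any
      -- `R`-neighbour as formal target.
      exact ⟨k, b, le_rfl, hb, fun i hi => by rw [if_neg (by omega), hc i hi]⟩
  choose l b hlk hb hlb using hl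
  refine ⟨l, b, hlk, hb, fun i hi c => hlb c i hi, fun i hi => ?_⟩
  have h1 := (hx 0 i (Nat.zero_le _) hi).1
  rw [hammingDist, Nat.sub_zero] at h1
  rw [← h1]
  congr 1
  ext c
  have hne : x 0 c ≠ b c := fun h => hirr _ (by simpa [← h] using hb c)
  rw [Finset.mem_filter, Finset.mem_filter, hlb c i hi]
  by_cases h : l c ≤ i <;> simp [h, hne]

end Hamming

namespace WreathProduct

variable {H ι Δ : Type*} [Group H] [MulAction H Δ] [Fintype ι] [DecidableEq Δ]

theorem productDist_smul {R : Δ → Δ → Prop} (hinv : ∀ (h : H) a b, R a b → R (h • a) (h • b))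
    (g : WreathProduct H ι) (n : ℕ) (x y : ι → Δ) (h : productDist R n x y) :
    productDist R n (g • x) (g • y) := by
  classical
  refine ⟨?_, fun c hc => ?_⟩
  · rw [← h.1, hammingDist, hammingDist]
    refine Finset.card_bij' (fun c _ => g.perm.symm c) (fun c _ => g.perm c) ?_ ?_ ?_ ?_ <;>
      simp [smul_apply]
  · rw [smul_apply, smul_apply] at hc ⊢
    exact hinv _ _ _ (h.2 _ fun h => hc (by rw [h]))

/-- By time `i < k` exactly `2 * i` coordinates have jumped, in either geodesic, so some permutation
of coordinates matches the jump times. Transitivity of `H` on `R`-pairs then matches initial and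
target values coordinate by coordinate. -/
theorem exists_smul_geodesic {R : Δ → Δ → Prop} (hirr : ∀ a, ¬ R a a) (hex : ∀ a, ∃ b, R a b)
    (htrans : ∀ a b a' b', R a b → R a' b' → ∃ h : H, h • a = a' ∧ h • b = b') {k : ℕ}
    {x y : ℕ → ι → Δ} (hx : ∀ i j, i ≤ j → j < k → productDist R (j - i) (x i) (x j))
    (hy : ∀ i j, i ≤ j → j < k → productDist R (j - i) (y i) (y j)) :
    ∃ g : WreathProduct H ι, ∀ i < k, g • x i = y i := by
  obtain ⟨l, b, hlk, hb, hlb, hcard⟩ := exists_jump hirr hex hx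
  obtain ⟨l', b', hlk', hb', hlb', hcard'⟩ := exists_jump hirr hex hy
  obtain ⟨σ, hσ⟩ := exists_perm_of_card_filter_le l l' fun i => by
    by_cases hi : i < k
    · rw [hcard i hi, hcard' i hi]
    · have h1 : ∀ c, l c ≤ i := fun c => (hlk c).trans (not_lt.1 hi)
      have h2 : ∀ c, l' c ≤ i := fun c => (hlk' c).trans (not_lt.1 hi)
      simp [h1, h2]
  choose f hf hf' using fun c => htrans _ _ _ _ (hb (σ.symm c)) (hb' c)
  refine ⟨⟨f, σ⟩, fun i hi => funext fun c => ?_⟩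
  have hl : l' c = l (σ.symm c) := by rw [← hσ, Equiv.apply_symm_apply]
  rw [smul_apply, hlb i hi, hlb' i hi, hl]
  split_ifs
  · exact hf' c
  · exact hf c

end WreathProduct

/-- Wreath products with large symmetric groups in product action admit uniform geometries. -/
theorem IsProductFactor.exists_isUniform {H Δ : Type} [Group H] [MulAction H Δ]
    (hH : IsProductFactor H Δ) (k : ℕ) {m : ℕ} (hm : 2 * (k + 2) ≤ m) :
    ∃ (X : Type) (_ : Finite X) (_ : MulAction (WreathProduct H (Fin m)) X)
      (Γ : Pregeometry X (Fin k)), Γ.IsUniform (WreathProduct H (Fin m)) (Fin m → Δ) := by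
  classical
  obtain ⟨R, hsymm, hirr, hinv, hex, htrans⟩ := hH.exists_orbital
  have := hH.finite
  have := hH.nontrivial
  have := hH.primitive
  have := WreathProduct.isPreprimitive (ι := Fin m) hH.moves
  exact (isGeodesicSystem_productDist hsymm hirr hex (K := k + 2)
    (by simpa using hm)).exists_isUniform (by omega) (by omega) _
    (WreathProduct.productDist_smul hinv)
    fun x y => WreathProduct.exists_smul_geodesic hirr hex htrans

/-! ### Minimal normal subgroups and their behaviour under wreath products -/

section MinimalNormal

variable {G : Type*} [Group G]

/-- The subgroup `N` is the least nontrivial normal subgroup. -/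
structure IsMonolith (N : Subgroup G) : Prop where
  normal : N.Normal
  ne_bot : N ≠ ⊥
  le : ∀ K : Subgroup G, K.Normal → K ≠ ⊥ → N ≤ K

theorem IsMonolith.isUniqueMinimalNormal {N : Subgroup G} (h : IsMonolith N) :
    IsUniqueMinimalNormal N := by
  intro K
  constructor
  · intro hK
    exact le_antisymm (hK.2 ⟨h.normal, h.ne_bot⟩ (h.le K hK.1.1 hK.1.2)) (h.le K hK.1.1 hK.1.2)
  · rintro rfl
    exact ⟨⟨h.normal, h.ne_bot⟩, fun L hL _ => h.le L hL.1 hL.2⟩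

theorem isMonolith_top [IsSimpleGroup G] : IsMonolith (⊤ : Subgroup G) where
  normal := inferInstance
  ne_bot := top_ne_bot
  le _ hK hne := (hK.eq_bot_or_eq_top.resolve_left hne).ge

/-- Two incomparable nontrivial normal subgroups, such that every nontrivial normal subgroup
contains one of them. -/
structure IsBimonolith (M N : Subgroup G) : Prop where
  normal_left : M.Normal
  normal_right : N.Normal
  ne_bot_left : M ≠ ⊥
  ne_bot_right : N ≠ ⊥
  not_le : ¬ M ≤ N
  not_ge : ¬ N ≤ M
  le_or_le : ∀ K : Subgroup G, K.Normal → K ≠ ⊥ → M ≤ K ∨ N ≤ K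

theorem IsBimonolith.isMinimalNormal_iff {M N : Subgroup G} (h : IsBimonolith M N)
    (K : Subgroup G) : IsMinimalNormal K ↔ K = M ∨ K = N := by
  constructor
  · intro hK
    rcases h.le_or_le K hK.1.1 hK.1.2 with hle | hle
    · exact Or.inl (le_antisymm (hK.2 ⟨h.normal_left, h.ne_bot_left⟩ hle) hle)
    · exact Or.inr (le_antisymm (hK.2 ⟨h.normal_right, h.ne_bot_right⟩ hle) hle)
  · rintro (rfl | rfl)
    · exact ⟨⟨h.normal_left, h.ne_bot_left⟩, fun L hL hle =>
        (h.le_or_le L hL.1 hL.2).resolve_right fun h' => h.not_ge (h'.trans hle)⟩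
    · exact ⟨⟨h.normal_right, h.ne_bot_right⟩, fun L hL hle =>
        (h.le_or_le L hL.1 hL.2).resolve_left fun h' => h.not_le (h'.trans hle)⟩

end MinimalNormal

section Product

variable {H Δ : Type*} [Group H] [MulAction H Δ] {ι : Type*} [Finite ι] [Nonempty ι]

theorem IsMonolith.baseSubgroup (hH : IsProductFactor H Δ) {N : Subgroup H} (hN : IsMonolith N) :
    IsMonolith (WreathProduct.baseSubgroup ι N) where
  normal := WreathProduct.baseSubgroup_normal hN.normal
  ne_bot := WreathProduct.baseSubgroup_ne_bot hN.ne_bot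
  le K hK hne := by
    have := hH.nontrivial_group
    obtain ⟨L, hL, hL', hle⟩ :=
      WreathProduct.exists_baseSubgroup_le hH.eq_one_of_central hK hne
    exact (WreathProduct.baseSubgroup_mono (hN.le L hL hL')).trans hle

theorem IsBimonolith.baseSubgroup (hH : IsProductFactor H Δ) {M N : Subgroup H}
    (h : IsBimonolith M N) :
    IsBimonolith (WreathProduct.baseSubgroup ι M) (WreathProduct.baseSubgroup ι N) where
  normal_left := WreathProduct.baseSubgroup_normal h.normal_left
  normal_right := WreathProduct.baseSubgroup_normal h.normal_right
  ne_bot_left := WreathProduct.baseSubgroup_ne_bot h.ne_bot_left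
  ne_bot_right := WreathProduct.baseSubgroup_ne_bot h.ne_bot_right
  not_le hle := h.not_le (WreathProduct.baseSubgroup_le_iff.1 hle)
  not_ge hle := h.not_ge (WreathProduct.baseSubgroup_le_iff.1 hle)
  le_or_le K hK hne := by
    have := hH.nontrivial_group
    obtain ⟨L, hL, hL', hle⟩ :=
      WreathProduct.exists_baseSubgroup_le hH.eq_one_of_central hK hne
    exact (h.le_or_le L hL hL').imp (fun h => (WreathProduct.baseSubgroup_mono h).trans hle)
      fun h => (WreathProduct.baseSubgroup_mono h).trans hle

omit [Finite ι] [Nonempty ι] in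
theorem ActsRegularly.baseSubgroup {N : Subgroup H} (h : ActsRegularly N Δ) :
    ActsRegularly (WreathProduct.baseSubgroup ι N) (ι → Δ) := by
  refine ⟨⟨fun x y => ?_⟩, fun α => ?_⟩
  · have := h.1
    choose f hf using fun i => exists_smul_eq N (x i) (y i)
    exact ⟨⟨⟨fun i => f i, 1⟩, rfl, fun i => (f i).2⟩, funext hf⟩
  · rw [Subgroup.eq_bot_iff_forall]
    intro g hg
    have h1 : (⟨g, hg⟩ : stabilizer (WreathProduct.baseSubgroup ι N) α) = 1 := by
      refine (WreathProduct.stabilizerBaseSubgroupEquiv N α).injective ?_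
      funext i
      have : Subsingleton (stabilizer N (α i)) := by
        rw [h.2 (α i)]
        infer_instance
      exact Subsingleton.elim _ _
    exact congrArg Subtype.val h1

end Product

/-- Flattening a direct power of a direct power. -/
def MulEquiv.finCurry (m n : ℕ) (T : Type*) [Group T] :
    (Fin m → Fin n → T) ≃* (Fin (m * n) → T) where
  toFun f j := f (finProdFinEquiv.symm j).1 (finProdFinEquiv.symm j).2
  invFun f i j := f (finProdFinEquiv (i, j))
  left_inv f := by
    funext i j
    simp
  right_inv f := by
    funext j
    exact congrArg f (finProdFinEquiv.apply_symm_apply j)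
  map_mul' _ _ := rfl

namespace IsProductFactor

variable {H Δ : Type} [Group H] [MulAction H Δ] (hH : IsProductFactor H Δ) {T : Type} [Group T]
  (hT : IsNonabelianSimple T)

include hH

theorem isPrimitiveGroupOfType_wreathProduct {τ : ONanScottType} {m : ℕ} (hm : 0 < m)
    (h : τ.DefiningProperty (WreathProduct H (Fin m)) (Fin m → Δ)) :
    IsPrimitiveGroupOfType τ (WreathProduct H (Fin m)) (Fin m → Δ) := by
  have := hH.finite
  have := hH.nontrivial
  have := hH.primitive
  have := hH.faithful
  have : NeZero m := ⟨hm.ne'⟩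
  exact ⟨inferInstance, inferInstance, inferInstance, WreathProduct.isPreprimitive hH.moves, h⟩

theorem definingProperty_HA {N : Subgroup H} (hN : IsMonolith N)
    (hab : ∀ a ∈ N, ∀ b ∈ N, a * b = b * a) {m : ℕ} (hm : 0 < m) :
    ONanScottType.HA.DefiningProperty (WreathProduct H (Fin m)) (Fin m → Δ) := by
  have : NeZero m := ⟨hm.ne'⟩
  refine ⟨WreathProduct.baseSubgroup (Fin m) N,
    ((hN.baseSubgroup hH).isUniqueMinimalNormal _).2 rfl, fun a ha b hb => ?_⟩
  have := (WreathProduct.baseSubgroupEquiv (Fin m) N).injective (a₁ := ⟨a, ha⟩ * ⟨b, hb⟩)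
    (a₂ := ⟨b, hb⟩ * ⟨a, ha⟩) (by
      rw [map_mul, map_mul]
      funext i
      exact Subtype.ext (hab _ (ha.2 i) _ (hb.2 i)))
  exact congrArg Subtype.val this

include hT

theorem definingProperty_HC {M N : Subgroup H} (h : IsBimonolith M N) (eM : M ≃* T) (eN : N ≃* T)
    {m : ℕ} (hm : 2 ≤ m) :
    ONanScottType.HC.DefiningProperty (WreathProduct H (Fin m)) (Fin m → Δ) := by
  have : NeZero m := ⟨by omega⟩
  have hb := h.baseSubgroup (ι := Fin m) hH
  refine ⟨T, inferInstance, hT, m, hm, WreathProduct.baseSubgroup (Fin m) M,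
    WreathProduct.baseSubgroup (Fin m) N, fun he => hb.not_le he.le, hb.isMinimalNormal_iff,
    ⟨(WreathProduct.baseSubgroupEquiv (Fin m) M).trans (MulEquiv.piCongrRight fun _ => eM)⟩,
    ⟨(WreathProduct.baseSubgroupEquiv (Fin m) N).trans (MulEquiv.piCongrRight fun _ => eN)⟩⟩

theorem definingProperty_TW {N : Subgroup H} (hN : IsMonolith N) {n : ℕ} (hn : 2 ≤ n)
    (e : N ≃* (Fin n → T)) (hreg : ActsRegularly N Δ) {m : ℕ} (hm : 0 < m) :
    ONanScottType.TW.DefiningProperty (WreathProduct H (Fin m)) (Fin m → Δ) := by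
  have : NeZero m := ⟨hm.ne'⟩
  exact ⟨T, inferInstance, hT, m * n, by nlinarith, WreathProduct.baseSubgroup (Fin m) N,
    (hN.baseSubgroup hH).isUniqueMinimalNormal,
    ⟨((WreathProduct.baseSubgroupEquiv (Fin m) N).trans
      (MulEquiv.piCongrRight fun _ => e)).trans (MulEquiv.finCurry m n T)⟩, hreg.baseSubgroup⟩

theorem definingProperty_CD {N : Subgroup H} (hN : IsMonolith N) {n : ℕ} (hn : 1 ≤ n)
    (e : N ≃* (Fin n → T)) (hs : ∀ a : Δ, Nonempty (stabilizer N a ≃* T)) {m : ℕ} (hm : 2 ≤ m) :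
    ONanScottType.CD.DefiningProperty (WreathProduct H (Fin m)) (Fin m → Δ) := by
  have : NeZero m := ⟨by omega⟩
  refine ⟨T, inferInstance, hT, m * n, by nlinarith, WreathProduct.baseSubgroup (Fin m) N,
    (hN.baseSubgroup hH).isUniqueMinimalNormal,
    ⟨((WreathProduct.baseSubgroupEquiv (Fin m) N).trans
      (MulEquiv.piCongrRight fun _ => e)).trans (MulEquiv.finCurry m n T)⟩, m, hm, fun α => ?_⟩
  exact ⟨(WreathProduct.stabilizerBaseSubgroupEquiv N α).trans
    (MulEquiv.piCongrRight fun i => (hs (α i)).some)⟩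

/-- The stabiliser is a product of groups of order prime to `p`, whereas `p` divides the order of
every nontrivial power of `T`. -/
theorem definingProperty_PA {N : Subgroup H} (hN : IsMonolith N) (e : N ≃* T) {p : ℕ}
    (hp : p.Prime) (hpT : p ∣ Nat.card T)
    (hs : ∀ a : Δ, ¬ p ∣ Nat.card (stabilizer N a) ∧ stabilizer N a ≠ ⊥) {m : ℕ} (hm : 2 ≤ m) :
    ONanScottType.PA.DefiningProperty (WreathProduct H (Fin m)) (Fin m → Δ) := by
  have : NeZero m := ⟨by omega⟩
  refine ⟨T, inferInstance, hT, m, hm, WreathProduct.baseSubgroup (Fin m) N,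
    (hN.baseSubgroup hH).isUniqueMinimalNormal,
    ⟨(WreathProduct.baseSubgroupEquiv (Fin m) N).trans (MulEquiv.piCongrRight fun _ => e)⟩,
    fun α => ⟨fun hbot => ?_, fun l hl => ⟨fun f => ?_⟩⟩⟩
  · obtain ⟨g, hg, hne⟩ := Subgroup.exists_mem_ne_one (hs (α 0)).2
    have hsub : Subsingleton (stabilizer (WreathProduct.baseSubgroup (Fin m) N) α) := by
      rw [hbot]
      infer_instance
    have := congrFun ((WreathProduct.stabilizerBaseSubgroupEquiv N α).symm.injective
      (Subsingleton.elim ((WreathProduct.stabilizerBaseSubgroupEquiv N α).symm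
        (Pi.mulSingle 0 ⟨g, hg⟩)) ((WreathProduct.stabilizerBaseSubgroupEquiv N α).symm 1))) 0
    rw [Pi.mulSingle_eq_same] at this
    exact hne (congrArg Subtype.val this)
  · have h1 := Nat.card_congr f.toEquiv
    rw [Nat.card_congr (WreathProduct.stabilizerBaseSubgroupEquiv N α).toEquiv, Nat.card_pi,
      Nat.card_fun, Nat.card_eq_fintype_card (α := Fin l), Fintype.card_fin] at h1
    have h2 : p ∣ ∏ i, Nat.card (stabilizer N (α i)) := by
      rw [h1]
      exact dvd_pow hpT (by omega)
    obtain ⟨i, -, hi⟩ := (hp.prime.dvd_finsetProd_iff _).1 h2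
    exact (hs (α i)).1 hi

end IsProductFactor

/-! ### Groups acting on `T` by two-sided multiplication -/

/-- A transitive action on a group that contains all left translations is primitive if the
stabiliser of the identity leaves no proper nontrivial subgroup invariant. -/
theorem isPreprimitive_of_invariant_subgroups {G N : Type*} [Group G] [Group N] [MulAction G N]
    (htr : ∀ n : N, ∃ g : G, ∀ x : N, g • x = n * x)
    (h : ∀ K : Subgroup N, (∀ g : G, g • (1 : N) = 1 → ∀ x ∈ K, g • x ∈ K) → K = ⊥ ∨ K = ⊤) :
    IsPreprimitive G N := by
  have : IsPretransitive G N := by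
    refine ⟨fun x y => ?_⟩
    obtain ⟨g, hg⟩ := htr (y * x⁻¹)
    exact ⟨g, by simp [hg]⟩
  refine IsPreprimitive.of_isTrivialBlock_base 1 fun {B} h1 hB => ?_
  have hstab : ∀ {g : G} {x}, x ∈ B → g • x ∈ B → g • B = B := fun hx hgx =>
    hB.smul_eq_of_mem hx hgx
  have hmul : ∀ b ∈ B, ∀ g : G, (∀ x : N, g • x = b * x) → g • B = B := by
    intro b hb g hg
    exact hstab h1 (by rw [hg, mul_one]; exact hb)
  -- A block containing the identity is stabilised by left translation by each of its elements,
  -- hence is a subgroup.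
  let K : Subgroup N :=
    { carrier := B
      one_mem' := h1
      mul_mem' := by
        intro a b ha hb
        obtain ⟨g, hg⟩ := htr a
        rw [← hg b, ← hmul a ha g hg]
        exact Set.smul_mem_smul_set hb
      inv_mem' := by
        intro a ha
        obtain ⟨g, hg⟩ := htr a
        have h1' : (1 : N) ∈ g • B := by rwa [hmul a ha g hg]
        rw [Set.mem_smul_set_iff_inv_smul_mem] at h1'
        rwa [show g⁻¹ • (1 : N) = a⁻¹ by rw [inv_smul_eq_iff, hg, mul_inv_cancel]] at h1' }
  have hK : (K : Set N) = B := rfl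
  rcases h K fun g hg x hx => by
      have : g • B = B := hstab h1 (by rw [hg]; exact h1)
      change g • x ∈ B
      rw [← this]
      exact Set.smul_mem_smul_set hx with hbot | htop
  · left
    rw [← hK, hbot, Subgroup.coe_bot]
    exact Set.subsingleton_singleton
  · right
    rw [← hK, htop, Subgroup.coe_top]

theorem IsNonabelianSimple.eq_one_of_central {T : Type*} [Group T] (hT : IsNonabelianSimple T)
    (z : T) (hz : ∀ h, h * z = z * h) : z = 1 := by
  have := hT.1
  rcases (inferInstance : (Subgroup.center T).Normal).eq_bot_or_eq_top with h | h
  · rw [← Subgroup.mem_bot, ← h, Subgroup.mem_center_iff]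
    exact hz
  · refine absurd (fun a b => ?_) hT.2
    have : b ∈ Subgroup.center T := h ▸ Subgroup.mem_top b
    exact Subgroup.mem_center_iff.1 this a

section TwoSided

/-- The group acts on `T` by transformations that include all `x ↦ a * x * b⁻¹`. -/
def ContainsTwoSided (G T : Type*) [Group G] [Group T] [MulAction G T] : Prop :=
  ∀ a b : T, ∃ g : G, ∀ x : T, g • x = a * x * b⁻¹

variable {G T : Type*} [Group G] [Group T] [MulAction G T]

/-- The stabiliser of the identity contains all conjugations, so an invariant subgroup is normal in
`T`. -/
theorem ContainsTwoSided.isPreprimitive (hG : ContainsTwoSided G T) [IsSimpleGroup T] :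
    IsPreprimitive G T := by
  refine isPreprimitive_of_invariant_subgroups (fun n => ?_) fun K hK => ?_
  · obtain ⟨g, hg⟩ := hG n 1
    exact ⟨g, fun x => by simp [hg]⟩
  · refine Subgroup.Normal.eq_bot_or_eq_top ⟨fun x hx t => ?_⟩
    obtain ⟨g, hg⟩ := hG t t
    rw [← hg]
    exact hK g (by simp [hg]) x hx

/-- Conjugation by an element not commuting with `b` fixes 1 and moves `b`; left multiplication by
an involution `t` swaps 1 and `t`. -/
theorem ContainsTwoSided.isProductFactor (hG : ContainsTwoSided G T) [Finite T]
    (hT : IsNonabelianSimple T) (hf : FaithfulSMul G T) (hinv : ∃ t : T, t ≠ 1 ∧ t * t = 1) :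
    IsProductFactor G T := by
  have := hT.1
  have hprim := hG.isPreprimitive
  refine ⟨inferInstance, hf, hprim, moves_of_base 1 fun b hb => ?_, ?_⟩
  · obtain ⟨t, ht⟩ : ∃ t, t * b ≠ b * t := by
      by_contra hcon
      push Not at hcon
      exact hb (hT.eq_one_of_central b hcon)
    obtain ⟨g, hg⟩ := hG t t
    exact ⟨g, by simp [hg], fun h => ht (by rwa [hg, mul_inv_eq_iff_eq_mul] at h)⟩
  · obtain ⟨t, ht, ht2⟩ := hinv
    obtain ⟨g, hg⟩ := hG t 1
    exact ⟨1, t, ht.symm, g, by simp [hg], by simp [hg, ht2]⟩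

end TwoSided

/-- The group `T × T`, acting on `T` by left and right multiplication. -/
def TwoSided (T : Type*) := T × T

namespace TwoSided

variable {T : Type*} [Group T]

instance : Group (TwoSided T) := inferInstanceAs (Group (T × T))

instance : MulAction (TwoSided T) T where
  smul g x := g.1 * x * g.2⁻¹
  one_smul x := by
    change 1 * x * 1⁻¹ = x
    simp
  mul_smul g h x := by
    change g.1 * h.1 * x * (g.2 * h.2)⁻¹ = g.1 * (h.1 * x * h.2⁻¹) * g.2⁻¹
    simp [mul_assoc]

theorem smul_def (g : TwoSided T) (x : T) : g • x = g.1 * x * g.2⁻¹ := rfl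

theorem containsTwoSided : ContainsTwoSided (TwoSided T) T := fun a b => ⟨(a, b), fun _ => rfl⟩

theorem faithfulSMul (hT : IsNonabelianSimple T) : FaithfulSMul (TwoSided T) T := by
  refine faithfulSMul_of_eq_one fun g hg => ?_
  have h1 : g.1 = g.2 := by
    have := hg 1
    rwa [smul_def, mul_one, mul_inv_eq_one] at this
  have h2 : g.2 = 1 := hT.eq_one_of_central _ fun x => by
    have := hg x
    rw [smul_def, mul_inv_eq_iff_eq_mul, h1] at this
    exact this.symm
  exact Prod.ext (h1.trans h2) h2

variable (T) in
/-- The group of left translations. -/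
def left : Subgroup (TwoSided T) := (MonoidHom.snd T T).ker

variable (T) in
/-- The group of right translations. -/
def right : Subgroup (TwoSided T) := (MonoidHom.fst T T).ker

theorem mem_left {g : TwoSided T} : g ∈ left T ↔ g.2 = 1 := Iff.rfl

theorem mem_right {g : TwoSided T} : g ∈ right T ↔ g.1 = 1 := Iff.rfl

/-- The left translation by an element. -/
def inl : T →* TwoSided T := MonoidHom.inl T T

/-- The right translation by the inverse of an element. -/
def inr : T →* TwoSided T := MonoidHom.inr T T

/-- The group of left translations is isomorphic to `T`. -/
def leftEquiv : left T ≃* T where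
  toFun g := g.1.1
  invFun t := ⟨inl t, mem_left.2 rfl⟩
  left_inv g := Subtype.ext (Prod.ext rfl (mem_left.1 g.2).symm)
  right_inv _ := rfl
  map_mul' _ _ := rfl

/-- The group of right translations is isomorphic to `T`. -/
def rightEquiv : right T ≃* T where
  toFun g := g.1.2
  invFun t := ⟨inr t, mem_right.2 rfl⟩
  left_inv g := Subtype.ext (Prod.ext (mem_right.1 g.2).symm rfl)
  right_inv _ := rfl
  map_mul' _ _ := rfl

/-- The commutator of `g` with a left translation is a left translation, nontrivial for a suitable
choice since `g.1` is not central. Simplicity of `T` does the rest. -/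
theorem left_le_of_ne_one (hT : IsNonabelianSimple T) {K : Subgroup (TwoSided T)} (hK : K.Normal)
    {g : TwoSided T} (hg : g ∈ K) (h1 : g.1 ≠ 1) : left T ≤ K := by
  have := hT.1
  obtain ⟨t, ht⟩ : ∃ t, t * g.1 ≠ g.1 * t := by
    by_contra hcon
    push Not at hcon
    exact h1 (hT.eq_one_of_central _ hcon)
  let L : Subgroup T := K.comap inl
  have hL : L.Normal := hK.comap inl
  have hne : L ≠ ⊥ := by
    intro hbot
    have hmem : t * g.1 * t⁻¹ * g.1⁻¹ ∈ L := by
      have := K.mul_mem (hK.conj_mem g hg (inl t)) (K.inv_mem hg)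
      rwa [show inl t * g * (inl t)⁻¹ * g⁻¹ = inl (t * g.1 * t⁻¹ * g.1⁻¹) from
        Prod.ext rfl (show 1 * g.2 * 1⁻¹ * g.2⁻¹ = 1 by simp)] at this
    rw [hbot, Subgroup.mem_bot, mul_inv_eq_one, mul_inv_eq_iff_eq_mul] at hmem
    exact ht hmem
  have htop := hL.eq_bot_or_eq_top.resolve_left hne
  intro x hx
  have : x.1 ∈ L := htop ▸ Subgroup.mem_top _
  rwa [show x = inl x.1 from Prod.ext rfl (mem_left.1 hx)]

theorem right_le_of_ne_one (hT : IsNonabelianSimple T) {K : Subgroup (TwoSided T)} (hK : K.Normal)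
    {g : TwoSided T} (hg : g ∈ K) (h1 : g.2 ≠ 1) : right T ≤ K := by
  have := hT.1
  obtain ⟨t, ht⟩ : ∃ t, t * g.2 ≠ g.2 * t := by
    by_contra hcon
    push Not at hcon
    exact h1 (hT.eq_one_of_central _ hcon)
  let L : Subgroup T := K.comap inr
  have hL : L.Normal := hK.comap inr
  have hne : L ≠ ⊥ := by
    intro hbot
    have hmem : t * g.2 * t⁻¹ * g.2⁻¹ ∈ L := by
      have := K.mul_mem (hK.conj_mem g hg (inr t)) (K.inv_mem hg)
      rwa [show inr t * g * (inr t)⁻¹ * g⁻¹ = inr (t * g.2 * t⁻¹ * g.2⁻¹) from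
        Prod.ext (show 1 * g.1 * 1⁻¹ * g.1⁻¹ = 1 by simp) rfl] at this
    rw [hbot, Subgroup.mem_bot, mul_inv_eq_one, mul_inv_eq_iff_eq_mul] at hmem
    exact ht hmem
  have htop := hL.eq_bot_or_eq_top.resolve_left hne
  intro x hx
  have : x.2 ∈ L := htop ▸ Subgroup.mem_top _
  rwa [show x = inr x.2 from Prod.ext (mem_right.1 hx) rfl]

theorem isBimonolith (hT : IsNonabelianSimple T) : IsBimonolith (left T) (right T) := by
  have := hT.1
  obtain ⟨t, ht⟩ := exists_ne (1 : T)
  have hl : inl t ∈ left T := mem_left.2 rfl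
  have hr : inr t ∈ right T := mem_right.2 rfl
  have hl' : inl t ∉ right T := fun h => ht (mem_right.1 h)
  have hr' : inr t ∉ left T := fun h => ht (mem_left.1 h)
  refine ⟨?_, ?_, fun h => hr' ?_, fun h => hl' ?_, fun h => hl' (h hl), fun h => hr' (h hr), ?_⟩
  · exact MonoidHom.normal_ker _
  · exact MonoidHom.normal_ker _
  · rw [h, Subgroup.mem_bot] at hl
    exact absurd (congrArg Prod.fst hl) ht
  · rw [h, Subgroup.mem_bot] at hr
    exact absurd (congrArg Prod.snd hr) ht
  · intro K hK hne
    obtain ⟨g, hg, hg1⟩ := Subgroup.exists_mem_ne_one hne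
    by_cases h : g.1 = 1
    · exact Or.inr (right_le_of_ne_one hT hK hg fun h' => hg1 (Prod.ext h h'))
    · exact Or.inl (left_le_of_ne_one hT hK hg h)

end TwoSided

/-- The wreath product `T ≀ S₂` acts on `T`, the base group by left and right multiplication, the
top group by inversion. -/
instance WreathProduct.mulActionTwo {T : Type*} [Group T] :
    MulAction (WreathProduct T (Fin 2)) T where
  smul g x := g.base 0 * (if g.perm = 1 then x else x⁻¹) * (g.base 1)⁻¹
  one_smul x := by
    change 1 * (if (1 : Equiv.Perm (Fin 2)) = 1 then x else x⁻¹) * 1⁻¹ = x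
    simp
  mul_smul g h x := by
    have hp : ∀ σ : Equiv.Perm (Fin 2), σ = 1 ∨ σ = Equiv.swap 0 1 := by decide
    have hne : (Equiv.swap 0 1 : Equiv.Perm (Fin 2)) ≠ 1 := by decide
    change (g * h).base 0 * (if (g * h).perm = 1 then x else x⁻¹) * ((g * h).base 1)⁻¹ =
      g.base 0 * (if g.perm = 1 then h.base 0 * (if h.perm = 1 then x else x⁻¹) * (h.base 1)⁻¹ else
        (h.base 0 * (if h.perm = 1 then x else x⁻¹) * (h.base 1)⁻¹)⁻¹) * (g.base 1)⁻¹
    simp only [WreathProduct.mul_base, WreathProduct.mul_perm]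
    rcases hp g.perm with h1 | h1 <;> rcases hp h.perm with h2 | h2 <;>
      simp [h1, h2, hne, mul_assoc]

namespace WreathProduct

variable {T : Type*} [Group T]

theorem smul_two_def (g : WreathProduct T (Fin 2)) (x : T) :
    g • x = g.base 0 * (if g.perm = 1 then x else x⁻¹) * (g.base 1)⁻¹ := rfl

theorem containsTwoSided : ContainsTwoSided (WreathProduct T (Fin 2)) T :=
  fun a b => ⟨⟨![a, b], 1⟩, fun x => by simp [smul_two_def]⟩

theorem faithfulSMul_two (hT : IsNonabelianSimple T) :
    FaithfulSMul (WreathProduct T (Fin 2)) T := by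
  refine faithfulSMul_of_eq_one fun g hg => ?_
  have h1 : g.base 0 = g.base 1 := by
    have := hg 1
    rw [smul_two_def] at this
    simpa [mul_inv_eq_one] using this
  by_cases hp : g.perm = 1
  · have h2 : g.base 1 = 1 := hT.eq_one_of_central _ fun x => by
      have := hg x
      rw [smul_two_def, if_pos hp, mul_inv_eq_iff_eq_mul, h1] at this
      exact this.symm
    refine WreathProduct.ext (funext fun i => ?_) hp
    fin_cases i
    · exact h1.trans h2
    · exact h2
  -- Otherwise the anti-automorphism `x ↦ c * x⁻¹ * c⁻¹`, with `c = g.base 1`, is the identity,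
  -- which makes `T` commutative.
  · refine absurd (fun a b => ?_) hT.2
    have key : ∀ x : T, g.base 1 * x⁻¹ * (g.base 1)⁻¹ = x := fun x => by
      have := hg x
      rwa [smul_two_def, if_neg hp, h1] at this
    have hinv : ∀ x y : T, x * y = y * x := by
      intro x y
      have h := key (y * x)
      rw [mul_inv_rev] at h
      have : g.base 1 * (x⁻¹ * y⁻¹) * (g.base 1)⁻¹ =
          (g.base 1 * x⁻¹ * (g.base 1)⁻¹) * (g.base 1 * y⁻¹ * (g.base 1)⁻¹) := by group
      rw [← h, this, key, key]
    exact hinv a b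

theorem isMonolith_baseSubgroup_top (hT : IsNonabelianSimple T) (ι : Type*) [Finite ι]
    [Nonempty ι] : IsMonolith (baseSubgroup ι (⊤ : Subgroup T)) := by
  have := hT.1
  refine ⟨baseSubgroup_normal inferInstance, baseSubgroup_ne_bot top_ne_bot, fun K hK hne => ?_⟩
  obtain ⟨L, hL, hL', hle⟩ := exists_baseSubgroup_le hT.eq_one_of_central hK hne
  rwa [hL.eq_bot_or_eq_top.resolve_left hL'] at hle

/-- The base group is a direct power. -/
def baseSubgroupTopEquiv (ι : Type*) : baseSubgroup ι (⊤ : Subgroup T) ≃* (ι → T) :=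
  (baseSubgroupEquiv ι ⊤).trans (MulEquiv.piCongrRight fun _ => Subgroup.topEquiv)

/-- In the action of `T ≀ S₂` on `T`, point stabilisers in the base group are isomorphic to `T`. -/
def stabilizerTwoEquiv (α : T) :
    stabilizer (baseSubgroup (Fin 2) (⊤ : Subgroup T)) α ≃* T where
  toFun g := g.1.1.base 1
  invFun t := ⟨⟨⟨![α * t * α⁻¹, t], 1⟩, rfl, fun _ => trivial⟩, by
    rw [mem_stabilizer_iff, Subgroup.smul_def, smul_two_def]
    simp⟩
  left_inv := by
    rintro ⟨⟨g, hg, hg'⟩, hs⟩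
    refine Subtype.ext (Subtype.ext (WreathProduct.ext (funext fun i => ?_) hg.symm))
    rw [mem_stabilizer_iff, Subgroup.smul_def, smul_two_def] at hs
    simp only [hg, if_true] at hs
    fin_cases i
    · change α * g.base 1 * α⁻¹ = g.base 0
      rw [mul_inv_eq_iff_eq_mul] at hs ⊢
      exact hs.symm
    · rfl
  right_inv _ := rfl
  map_mul' := by
    rintro ⟨⟨g, hg, hg'⟩, hs⟩ ⟨⟨h, hh, hh'⟩, hs'⟩
    change g.base 1 * h.base (g.perm.symm 1) = g.base 1 * h.base 1
    rw [hg, symm_one_apply]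

theorem definingProperty_SD {T : Type} [Group T] (hT : IsNonabelianSimple T) :
    ONanScottType.SD.DefiningProperty (WreathProduct T (Fin 2)) T := by
  have := hT.1
  refine ⟨T, inferInstance, hT, 2, le_rfl, baseSubgroup (Fin 2) ⊤,
    (isMonolith_baseSubgroup_top hT _).isUniqueMinimalNormal, ⟨baseSubgroupTopEquiv _⟩,
    fun h => ?_, fun α => ⟨stabilizerTwoEquiv α⟩⟩
  obtain ⟨t, ht⟩ := exists_ne (1 : T)
  have hsub : Subsingleton (stabilizer (baseSubgroup (Fin 2) (⊤ : Subgroup T)) (1 : T)) := by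
    rw [h.2]
    infer_instance
  exact ht ((stabilizerTwoEquiv (1 : T)).symm.injective (Subsingleton.elim _ _))

end WreathProduct

theorem TwoSided.definingProperty_HS {T : Type} [Group T] (hT : IsNonabelianSimple T) :
    ONanScottType.HS.DefiningProperty (TwoSided T) T :=
  ⟨T, inferInstance, hT, left T, right T, fun h => (isBimonolith hT).not_le h.le,
    (isBimonolith hT).isMinimalNormal_iff, ⟨leftEquiv⟩, ⟨rightEquiv⟩⟩

/-! ### Cycle decompositions and simultaneous conjugation -/

namespace Equiv.Perm

variable {α : Type*} [Fintype α] [DecidableEq α]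

/-- The support of a product lies in the union of the supports, so additivity of sizes forces an
empty intersection. This is the equality case of the triangle inequality for `supportDist`. -/
theorem disjoint_of_card_support_mul {f g : Perm α}
    (h : (f * g).support.card = f.support.card + g.support.card) : Disjoint f g := by
  rw [disjoint_iff_disjoint_support, Finset.disjoint_iff_inter_eq_empty, ← Finset.card_eq_zero]
  have h1 := Finset.card_le_card (support_mul_le f g)
  have h2 := Finset.card_union_add_card_inter f.support g.support
  rw [Finset.sup_eq_union] at h1
  omega

theorem exists_mul_of_subset_cycleFactorsFinset {g : Perm α} {A : Finset (Perm α)}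
    (hA : A ⊆ g.cycleFactorsFinset) :
    ∃ u v : Perm α, g = u * v ∧ u.cycleFactorsFinset = A ∧
      v.cycleFactorsFinset = g.cycleFactorsFinset \ A := by
  obtain ⟨hc, hd, hg⟩ := cycleFactorsFinset_eq_finset.1 (rfl : g.cycleFactorsFinset = _)
  have hB : g.cycleFactorsFinset \ A ⊆ g.cycleFactorsFinset := Finset.sdiff_subset
  have hdA : (A : Set (Perm α)).Pairwise Disjoint := hd.mono (Finset.coe_subset.2 hA)
  have hdB : ((g.cycleFactorsFinset \ A : Finset _) : Set (Perm α)).Pairwise Disjoint :=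
    hd.mono (Finset.coe_subset.2 hB)
  refine ⟨A.noncommProd id fun x hx y hy h => (hdA hx hy h).commute,
    (g.cycleFactorsFinset \ A).noncommProd id fun x hx y hy h => (hdB hx hy h).commute, ?_,
    cycleFactorsFinset_eq_finset.2 ⟨fun f hf => hc f (hA hf), hdA, rfl⟩,
    cycleFactorsFinset_eq_finset.2 ⟨fun f hf => hc f (hB hf), hdB, rfl⟩⟩
  rw [← Finset.noncommProd_union_of_disjoint Finset.disjoint_sdiff]
  · conv_lhs => rw [← hg]
    congr 1
    exact (Finset.union_sdiff_of_subset hA).symm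
  · rw [Finset.union_sdiff_of_subset hA]
    exact fun x hx y hy h => (hd hx hy h).commute

theorem cycleType_eq_replicate_of_subset {f g : Perm α} {m n l : ℕ}
    (hg : g.cycleType = Multiset.replicate m l) (hfg : f.cycleFactorsFinset ⊆ g.cycleFactorsFinset)
    (hn : f.cycleFactorsFinset.card = n) : f.cycleType = Multiset.replicate n l := by
  rw [Multiset.eq_replicate]
  constructor
  · rw [cycleType_def, Multiset.card_map]
    exact hn
  · intro b hb
    rw [cycleType_def] at hb hg
    refine Multiset.eq_of_mem_replicate (n := m) (hg ▸ ?_)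
    exact Multiset.map_subset_map (show f.cycleFactorsFinset.1 ⊆ _ from hfg) hb

theorem card_cycleFactorsFinset_of_cycleType {g : Perm α} {m l : ℕ}
    (hg : g.cycleType = Multiset.replicate m l) : g.cycleFactorsFinset.card = m := by
  have := congrArg Multiset.card hg
  rwa [cycleType_def, Multiset.card_map, Multiset.card_replicate] at this

theorem card_support_of_cycleType_eq_replicate {g : Perm α} {m l : ℕ}
    (hg : g.cycleType = Multiset.replicate m l) : g.support.card = m * l := by
  rw [← sum_cycleType, hg, Multiset.sum_replicate, smul_eq_mul]

theorem mem_alternatingGroup_of_cycleType {g : Perm α} {m : ℕ}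
    (hg : g.cycleType = Multiset.replicate m 3) : g ∈ alternatingGroup α := by
  rw [mem_alternatingGroup, sign_of_cycleType, hg, Multiset.sum_replicate, Multiset.card_replicate,
    smul_eq_mul, Even.neg_one_pow ⟨2 * m, by ring⟩]

/-- Families of pairwise disjoint permutations with the same cycle types are simultaneously
conjugate. -/
theorem exists_conj_of_pairwise_disjoint {ι : Type*} [Fintype ι] {y z : ι → Perm α}
    (hy : Pairwise fun i j => Disjoint (y i) (y j)) (hz : Pairwise fun i j => Disjoint (z i) (z j))
    (h : ∀ i, (y i).cycleType = (z i).cycleType) : ∃ g : Perm α, ∀ i, g * y i * g⁻¹ = z i := by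
  classical
  choose σ hσ using fun i => isConj_iff.1 (isConj_iff_cycleType_eq.2 (h i))
  have hσy : ∀ i c, σ i (y i c) = z i (σ i c) := by
    intro i c
    rw [← hσ i]
    simp
  have hsup : ∀ i c, σ i c ∈ (z i).support ↔ c ∈ (y i).support := by
    intro i c
    rw [mem_support, mem_support, ← hσy, (σ i).injective.ne_iff]
  -- Glue the individual conjugators along the disjoint supports; the result is injective on their
  -- union because the image supports are disjoint too, and so extends to a permutation.
  let f : α → α := fun c => if h : ∃ i, c ∈ (y i).support then σ h.choose c else c
  have hf : ∀ i, ∀ c ∈ (y i).support, f c = σ i c := by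
    intro i c hc
    have h : ∃ i, c ∈ (y i).support := ⟨i, hc⟩
    have : h.choose = i := by
      by_contra hne
      exact Finset.disjoint_left.1 (hy hne).disjoint_support h.choose_spec hc
    simp only [f, dif_pos h, this]
  have hinj : Set.InjOn f (Finset.univ.biUnion fun i => (y i).support : Finset α) := by
    intro a ha b hb hab
    simp only [Finset.mem_coe, Finset.mem_biUnion, Finset.mem_univ, true_and] at ha hb
    obtain ⟨i, ha⟩ := ha
    obtain ⟨j, hb⟩ := hb
    rw [hf i a ha, hf j b hb] at hab
    by_cases hij : i = j
    · subst hij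
      exact (σ i).injective hab
    · have h1 := (hsup i a).2 ha
      rw [hab] at h1
      exact absurd ((hsup j b).2 hb) (Finset.disjoint_left.1 (hz hij).disjoint_support h1)
  obtain ⟨g₀, hg₀⟩ := Finset.exists_equiv_extend_of_card_eq (t := Finset.univ)
    (by rw [Finset.card_univ]) (Finset.subset_univ _) hinj
  let g : Perm α := g₀.trans (Equiv.subtypeUnivEquiv fun _ => Finset.mem_univ _)
  have hg : ∀ i, ∀ c ∈ (y i).support, g c = σ i c := by
    intro i c hc
    rw [← hf i c hc, ← hg₀ c (Finset.mem_biUnion.2 ⟨i, Finset.mem_univ _, hc⟩)]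
    rfl
  refine ⟨g, fun i => ?_⟩
  rw [mul_inv_eq_iff_eq_mul]
  ext c
  rw [mul_apply, mul_apply]
  by_cases hc : c ∈ (y i).support
  · rw [hg i c hc, hg i _ (apply_mem_support.2 hc), hσy]
  · rw [notMem_support.1 hc]
    -- A point of the support of `z i` is the image under `σ i`, hence under `g`, of a point of the
    -- support of `y i`; so `g` keeps the complements matched.
    refine (notMem_support.1 fun hgc => hc ?_).symm
    have h1 : (σ i)⁻¹ (g c) ∈ (y i).support := by
      rw [← hsup, ← mul_apply, mul_inv_cancel, one_apply]
      exact hgc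
    have h2 := hg i _ h1
    rw [← mul_apply (σ i), mul_inv_cancel, one_apply] at h2
    rwa [g.injective h2] at h1

/-- The cardinality bound leaves two points fixed by all `y i`. Their transposition commutes with
every `y i`, so it can be used to correct the sign of the conjugator. -/
theorem exists_conj_mem_alternatingGroup {ι : Type*} [Fintype ι] {y z : ι → Perm α}
    (hy : Pairwise fun i j => Disjoint (y i) (y j)) (hz : Pairwise fun i j => Disjoint (z i) (z j))
    (h : ∀ i, (y i).cycleType = (z i).cycleType) {r : ℕ} (hr : ∀ i, (y i).support.card ≤ r)
    (hcard : Fintype.card ι * r + 2 ≤ Fintype.card α) :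
    ∃ g ∈ alternatingGroup α, ∀ i, g * y i * g⁻¹ = z i := by
  classical
  obtain ⟨g, hg⟩ := exists_conj_of_pairwise_disjoint hy hz h
  have h1 := Finset.card_biUnion_le_card_mul Finset.univ (fun i => (y i).support) r fun i _ => hr i
  have h2 := Finset.card_compl_add_card (Finset.univ.biUnion fun i => (y i).support)
  rw [Finset.card_univ] at h1
  obtain ⟨p, hp, q, hq, hpq⟩ := Finset.one_lt_card.1
    (show 1 < (Finset.univ.biUnion fun i => (y i).support)ᶜ.card by omega)
  simp only [Finset.mem_compl, Finset.mem_biUnion, Finset.mem_univ, true_and, not_exists] at hp hq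
  rcases Int.units_eq_one_or (sign g) with hs | hs
  · exact ⟨g, mem_alternatingGroup.2 hs, hg⟩
  · refine ⟨g * swap p q, mem_alternatingGroup.2 (by rw [sign_mul, hs, sign_swap hpq]; rfl),
      fun i => ?_⟩
    have hcomm : swap p q * y i = y i * swap p q := by
      have hd : Disjoint (swap p q) (y i) := by
        rw [disjoint_iff_disjoint_support, support_swap hpq, Finset.disjoint_left]
        intro c hc
        rw [Finset.mem_insert, Finset.mem_singleton] at hc
        rcases hc with rfl | rfl
        · exact hp i
        · exact hq i
      exact hd.commute
    rw [mul_assoc g, hcomm, ← hg i]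
    group

end Equiv.Perm

/-! ### Geodesics in alternating groups -/

namespace alternatingGroup

open Equiv.Perm

variable {α : Type*} [Fintype α] [DecidableEq α]

/-- Two even permutations are related at distance `n` if they differ by a product of `2 * n`
disjoint 3-cycles. -/
def threeCycleDist (n : ℕ) (x y : alternatingGroup α) : Prop :=
  ((x⁻¹ * y : alternatingGroup α) : Equiv.Perm α).cycleType = Multiset.replicate (2 * n) 3

/-- The number of points at which two even permutations differ. -/
def supportDist (x y : alternatingGroup α) : ℕ :=
  ((x⁻¹ * y : alternatingGroup α) : Equiv.Perm α).support.card

theorem threeCycleDist.supportDist_eq {n : ℕ} {x y : alternatingGroup α}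
    (h : threeCycleDist n x y) : supportDist x y = 6 * n := by
  rw [supportDist, card_support_of_cycleType_eq_replicate h]
  ring

theorem inv_mul_eq (x y z : alternatingGroup α) :
    ((x⁻¹ * z : alternatingGroup α) : Equiv.Perm α) =
      ((x⁻¹ * y : alternatingGroup α) : Equiv.Perm α) *
        ((y⁻¹ * z : alternatingGroup α) : Equiv.Perm α) := by
  rw [← Subgroup.coe_mul, mul_assoc, mul_inv_cancel_left]

/-- The analogue of the Hamming case, with the 3-cycles of `x⁻¹ * y` in place of differing
coordinates: midpoints apply a subset of these cycles first. Length `K` needs `2 * K` disjoint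
3-cycles, hence `6 * K` points. -/
theorem isGeodesicSystem_threeCycleDist {K : ℕ} (hK : 6 * K ≤ Fintype.card α) :
    IsGeodesicSystem K 6 (supportDist (α := α)) threeCycleDist where
  zero x y := by
    rw [threeCycleDist, mul_zero, Multiset.replicate_zero, cycleType_eq_zero, OneMemClass.coe_eq_one,
      inv_mul_eq_one]
  symm n x y h := by
    rw [threeCycleDist] at h ⊢
    rw [← h, ← cycleType_inv, ← Subgroup.coe_inv, mul_inv_rev, inv_inv]
  dist_eq n x y h := h.supportDist_eq
  triangle x y z := by
    rw [supportDist, inv_mul_eq x y z]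
    exact (Finset.card_le_card (support_mul_le _ _)).trans (Finset.card_union_le _ _)
  comp p q x y z hxy hyz hxz := by
    have hd := disjoint_of_card_support_mul
      (f := ((x⁻¹ * y : alternatingGroup α) : Equiv.Perm α))
      (g := ((y⁻¹ * z : alternatingGroup α) : Equiv.Perm α)) (by
        rw [← inv_mul_eq]
        have h1 := hxy.supportDist_eq
        have h2 := hyz.supportDist_eq
        simp only [supportDist] at h1 h2 hxz
        rw [h1, h2, hxz]
        ring)
    rw [threeCycleDist] at hxy hyz ⊢
    rw [inv_mul_eq x y z, hd.cycleType_mul, hxy, hyz, ← Multiset.replicate_add, mul_add]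
  interp s t x y hs ht hxy := by
    classical
    have hS := card_cycleFactorsFinset_of_cycleType hxy
    have hex : ∀ A ⊆ ((x⁻¹ * y : alternatingGroup α) : Equiv.Perm α).cycleFactorsFinset,
        ∃ z : alternatingGroup α,
          ((x⁻¹ * z : alternatingGroup α) : Equiv.Perm α).cycleFactorsFinset = A ∧
          ((z⁻¹ * y : alternatingGroup α) : Equiv.Perm α).cycleFactorsFinset =
            ((x⁻¹ * y : alternatingGroup α) : Equiv.Perm α).cycleFactorsFinset \ A := by
      intro A hA
      obtain ⟨u, v, huv, hu, hv⟩ := exists_mul_of_subset_cycleFactorsFinset hA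
      have hu' : u ∈ alternatingGroup α := mem_alternatingGroup_of_cycleType
        (cycleType_eq_replicate_of_subset hxy (hu ▸ hA) rfl)
      refine ⟨x * ⟨u, hu'⟩, by simpa using hu, ?_⟩
      rw [← hv, mul_inv_rev, mul_assoc, Subgroup.coe_mul, huv, Subgroup.coe_inv,
        inv_mul_cancel_left]
    choose! f hf hf' using hex
    refine three_le_encard_of_powersetCard hs ht hS (f := f) (fun A hA hc => ⟨?_, ?_⟩)
      fun A hA B hB h => ?_
    · exact cycleType_eq_replicate_of_subset hxy (by rw [hf A hA]; exact hA) (by rw [hf A hA, hc])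
    · refine cycleType_eq_replicate_of_subset hxy
        (by rw [hf' A hA]; exact Finset.sdiff_subset) ?_
      rw [hf' A hA, Finset.card_sdiff_of_subset hA, hS, hc]
      omega
    · rw [← hf A hA, ← hf B hB, h]
  extend n x y hxy hn := by
    obtain ⟨g, hg⟩ := (exists_with_cycleType_iff α (m := Multiset.replicate (2 * K) 3)).2
      ⟨by rw [Multiset.sum_replicate, smul_eq_mul]; omega, fun a ha => by
        rw [Multiset.eq_of_mem_replicate ha]; norm_num⟩
    have hgc := card_cycleFactorsFinset_of_cycleType hg
    obtain ⟨A, hA, hAc⟩ := Finset.exists_subset_card_eq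
      (show 2 * n ≤ g.cycleFactorsFinset.card by omega)
    obtain ⟨u, v, huv, hu, hv⟩ := exists_mul_of_subset_cycleFactorsFinset hA
    have hu' := cycleType_eq_replicate_of_subset hg (hu ▸ hA) (by rw [hu, hAc])
    have hv' : v.cycleType = Multiset.replicate (2 * (K - n)) 3 := by
      refine cycleType_eq_replicate_of_subset hg (by rw [hv]; exact Finset.sdiff_subset) ?_
      rw [hv, Finset.card_sdiff_of_subset hA, hgc, hAc]
      omega
    -- Conjugate a product `g = u * v` of `2 * K` disjoint 3-cycles so that `u` becomes `x⁻¹ * y`;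
    -- the conjugate of `v` is then the prolongation.
    obtain ⟨τ, hτ⟩ := isConj_iff.1 (isConj_iff_cycleType_eq.2 (hu'.trans hxy.symm))
    have hw : (τ * v * τ⁻¹).cycleType = Multiset.replicate (2 * (K - n)) 3 := by
      rw [cycleType_conj, hv']
    refine ⟨y * ⟨τ * v * τ⁻¹, mem_alternatingGroup_of_cycleType hw⟩, ?_, ?_⟩
    · rw [threeCycleDist, inv_mul_cancel_left, hw]
    · rw [supportDist, ← mul_assoc, Subgroup.coe_mul, ← hτ]
      have : τ * u * τ⁻¹ * (τ * v * τ⁻¹) = τ * g * τ⁻¹ := by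
        rw [huv]
        group
      rw [this, card_support_of_cycleType_eq_replicate ((cycleType_conj).trans hg)]
      ring

theorem threeCycleDist_mul_mul_inv {n : ℕ} {x y : alternatingGroup α} (h : threeCycleDist n x y)
    (a b : alternatingGroup α) : threeCycleDist n (a * x * b⁻¹) (a * y * b⁻¹) := by
  have e : (((a * x * b⁻¹)⁻¹ * (a * y * b⁻¹) : alternatingGroup α) : Equiv.Perm α) =
      b * ((x⁻¹ * y : alternatingGroup α) : Equiv.Perm α) * (b : Equiv.Perm α)⁻¹ := by
    rw [← Subgroup.coe_inv, ← Subgroup.coe_mul, ← Subgroup.coe_mul]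
    congr 1
    group
  rw [threeCycleDist, e, cycleType_conj, h]

theorem threeCycleDist_inv {n : ℕ} {x y : alternatingGroup α} (h : threeCycleDist n x y) :
    threeCycleDist n x⁻¹ y⁻¹ := by
  have e : (((x⁻¹)⁻¹ * y⁻¹ : alternatingGroup α) : Equiv.Perm α) =
      x * ((x⁻¹ * y : alternatingGroup α) : Equiv.Perm α)⁻¹ * (x : Equiv.Perm α)⁻¹ := by
    rw [← Subgroup.coe_inv, ← Subgroup.coe_inv, ← Subgroup.coe_mul, ← Subgroup.coe_mul]
    congr 1
    group
  rw [threeCycleDist, e, cycleType_conj, cycleType_inv, h]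

/-- Step `i` is disjoint from the whole displacement from `x (i + 1)` to `x (j + 1)`, by additivity
of distance. The support of that displacement contains the support of step `j`, again by additivity.
-/
theorem disjoint_steps {k : ℕ} {x : ℕ → alternatingGroup α}
    (hx : ∀ i j, i ≤ j → j < k → threeCycleDist (j - i) (x i) (x j)) {i j : ℕ} (hij : i < j)
    (hj : j + 1 < k) :
    Disjoint (((x i)⁻¹ * x (i + 1) : alternatingGroup α) : Equiv.Perm α)
      (((x j)⁻¹ * x (j + 1) : alternatingGroup α) : Equiv.Perm α) := by
  have key : ∀ a b c, a ≤ b → b ≤ c → c < k →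
      Disjoint (((x a)⁻¹ * x b : alternatingGroup α) : Equiv.Perm α)
        (((x b)⁻¹ * x c : alternatingGroup α) : Equiv.Perm α) := by
    intro a b c hab hbc hc
    refine disjoint_of_card_support_mul ?_
    rw [← inv_mul_eq]
    have h1 := (hx a b hab (by omega)).supportDist_eq
    have h2 := (hx b c hbc hc).supportDist_eq
    have h3 := (hx a c (by omega) hc).supportDist_eq
    simp only [supportDist] at h1 h2 h3
    rw [h1, h2, h3]
    omega
  have h1 := key i (i + 1) (j + 1) (by omega) (by omega) hj
  have h2 := key (i + 1) j (j + 1) (by omega) (by omega) hj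
  rw [disjoint_iff_disjoint_support] at h1 ⊢
  refine Finset.disjoint_of_subset_right ?_ h1
  rw [inv_mul_eq (x (i + 1)) (x j), h2.support_mul]
  exact Finset.subset_union_right

/-- A group acting on an alternating group of large degree, containing all left and right
translations, is transitive on geodesics. -/
theorem exists_smul_geodesic {G : Type*} [Group G] [MulAction G (alternatingGroup α)]
    (hG : ContainsTwoSided G (alternatingGroup α)) {k : ℕ} (hk : 6 * k + 2 ≤ Fintype.card α)
    {x y : ℕ → alternatingGroup α}
    (hx : ∀ i j, i ≤ j → j < k → threeCycleDist (j - i) (x i) (x j))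
    (hy : ∀ i j, i ≤ j → j < k → threeCycleDist (j - i) (y i) (y j)) :
    ∃ g : G, ∀ i < k, g • x i = y i := by
  have hpw : ∀ x : ℕ → alternatingGroup α,
      (∀ i j, i ≤ j → j < k → threeCycleDist (j - i) (x i) (x j)) →
      Pairwise fun i j : Fin (k - 1) =>
        Disjoint (((x i)⁻¹ * x (i + 1) : alternatingGroup α) : Equiv.Perm α)
          (((x j)⁻¹ * x (j + 1) : alternatingGroup α) : Equiv.Perm α) := by
    intro x hx i j hij
    rcases lt_or_gt_of_ne hij with h | h
    · exact disjoint_steps hx h (by omega)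
    · exact (disjoint_steps hx h (by omega)).symm
  have hstep : ∀ x : ℕ → alternatingGroup α,
      (∀ i j, i ≤ j → j < k → threeCycleDist (j - i) (x i) (x j)) → ∀ i : Fin (k - 1),
        threeCycleDist 1 (x i) (x (i + 1)) := by
    intro x hx i
    simpa using hx i (i + 1) (by omega) (by omega)
  obtain ⟨g, hg, hgc⟩ := exists_conj_mem_alternatingGroup (hpw x hx) (hpw y hy)
    (fun i => (hstep x hx i).trans (hstep y hy i).symm) (r := 6)
    (fun i => (hstep x hx i).supportDist_eq.le) (by rw [Fintype.card_fin]; omega)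
  -- The displacement from the start is the product of the steps, so conjugating the steps
  -- conjugates it.
  have hconj : ∀ i < k, (⟨g, hg⟩ : alternatingGroup α) * ((x 0)⁻¹ * x i) * ⟨g, hg⟩⁻¹ =
      (y 0)⁻¹ * y i := by
    intro i
    induction i with
    | zero => simp
    | succ i ih =>
      intro hi
      have h1 := ih (by omega)
      have h2 : (⟨g, hg⟩ : alternatingGroup α) * ((x i)⁻¹ * x (i + 1)) * ⟨g, hg⟩⁻¹ =
          (y i)⁻¹ * y (i + 1) := Subtype.ext (hgc ⟨i, by omega⟩)
      calc (⟨g, hg⟩ : alternatingGroup α) * ((x 0)⁻¹ * x (i + 1)) * ⟨g, hg⟩⁻¹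
          = ((⟨g, hg⟩ : alternatingGroup α) * ((x 0)⁻¹ * x i) * ⟨g, hg⟩⁻¹) *
            ((⟨g, hg⟩ : alternatingGroup α) * ((x i)⁻¹ * x (i + 1)) * ⟨g, hg⟩⁻¹) := by group
        _ = (y 0)⁻¹ * y (i + 1) := by rw [h1, h2]; group
  obtain ⟨w, hw⟩ := hG (y 0 * ⟨g, hg⟩ * (x 0)⁻¹) ⟨g, hg⟩
  refine ⟨w, fun i hi => ?_⟩
  rw [hw, ← mul_inv_cancel_left (y 0) (y i), ← hconj i hi]
  group

theorem isNonabelianSimple (h : 5 ≤ Fintype.card α) : IsNonabelianSimple (alternatingGroup α) := by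
  have hs : IsSimpleGroup (alternatingGroup α) :=
    alternatingGroup.isSimpleGroup (by rwa [Nat.card_eq_fintype_card])
  refine ⟨hs, fun hab => ?_⟩
  have h1 := commutator_alternatingGroup_eq_top (α := α) (by rwa [Nat.card_eq_fintype_card])
  rw [commutator_def, Subgroup.commutator_eq_bot_iff_le_centralizer.2] at h1
  · exact bot_ne_top h1
  · intro a _
    rw [Subgroup.mem_centralizer_iff]
    exact fun b _ => hab b a

end alternatingGroup

/-- Groups that contain the left and right translations of an alternating group of large degree
and preserve the distances between even permutations admit uniform geometries. -/
theorem ContainsTwoSided.exists_isUniform {n : ℕ} {G : Type} [Group G]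
    [MulAction G (alternatingGroup (Fin n))] (hG : ContainsTwoSided G (alternatingGroup (Fin n)))
    {k : ℕ} (hn : 6 * (k + 2) ≤ n)
    (hinv : ∀ (g : G) m (x y : alternatingGroup (Fin n)), alternatingGroup.threeCycleDist m x y →
      alternatingGroup.threeCycleDist m (g • x) (g • y)) :
    ∃ (X : Type) (_ : Finite X) (_ : MulAction G X) (Γ : Pregeometry X (Fin k)),
      Γ.IsUniform G (alternatingGroup (Fin n)) := by
  have := (alternatingGroup.isNonabelianSimple (α := Fin n) (by simp; omega)).1
  have := hG.isPreprimitive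
  exact (alternatingGroup.isGeodesicSystem_threeCycleDist (α := Fin n) (K := k + 2)
    (by simpa using hn)).exists_isUniform (by omega) (by omega) G hinv
    fun x y => alternatingGroup.exists_smul_geodesic hG (by simp; omega)

theorem TwoSided.exists_isUniform {n k : ℕ} (hn : 6 * (k + 2) ≤ n) :
    ∃ (X : Type) (_ : Finite X) (_ : MulAction (TwoSided (alternatingGroup (Fin n))) X)
      (Γ : Pregeometry X (Fin k)),
      Γ.IsUniform (TwoSided (alternatingGroup (Fin n))) (alternatingGroup (Fin n)) :=
  containsTwoSided.exists_isUniform hn fun g _ _ _ h =>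
    alternatingGroup.threeCycleDist_mul_mul_inv h g.1 g.2

theorem WreathProduct.exists_isUniform_two {n k : ℕ} (hn : 6 * (k + 2) ≤ n) :
    ∃ (X : Type) (_ : Finite X)
      (_ : MulAction (WreathProduct (alternatingGroup (Fin n)) (Fin 2)) X)
      (Γ : Pregeometry X (Fin k)),
      Γ.IsUniform (WreathProduct (alternatingGroup (Fin n)) (Fin 2)) (alternatingGroup (Fin n)) :=
  containsTwoSided.exists_isUniform hn fun g m x y h => by
    rw [smul_two_def, smul_two_def]
    by_cases hp : g.perm = 1
    · rw [if_pos hp, if_pos hp]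
      exact alternatingGroup.threeCycleDist_mul_mul_inv h _ _
    · rw [if_neg hp, if_neg hp]
      exact alternatingGroup.threeCycleDist_mul_mul_inv (alternatingGroup.threeCycleDist_inv h) _ _

/-! ### Twisted wreath products -/

section Twisted

variable {T P : Type*} [Group T] [Group P]

/-- The base group of the twisted wreath product of `T` by `P` along the embedding `e : T →* P`,
consisting of the functions `P → T` equivariant under right translation by `T`, which acts on
itself by conjugation. -/
def twistedBase (e : T →* P) : Subgroup (P → T) where
  carrier := {f | ∀ p t, f (p * e t) = t⁻¹ * f p * t}
  one_mem' := fun p t => by simp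
  mul_mem' := by
    intro f g hf hg p t
    rw [Pi.mul_apply, Pi.mul_apply, hf, hg]
    group
  inv_mem' := by
    intro f hf p t
    rw [Pi.inv_apply, Pi.inv_apply, hf]
    group

namespace twistedBase

variable {e : T →* P}

theorem apply_mul (f : twistedBase e) (p : P) (t : T) : f.1 (p * e t) = t⁻¹ * f.1 p * t := f.2 p t

theorem apply_mul_eq_one_iff (f : twistedBase e) (p : P) (t : T) :
    f.1 (p * e t) = 1 ↔ f.1 p = 1 := by
  rw [apply_mul]
  constructor
  · intro h
    rw [mul_eq_one_iff_eq_inv] at h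
    simpa using h
  · intro h
    simp [h]

/-- Left translation of equivariant functions. -/
def translate (e : T →* P) : P →* MulAut (twistedBase e) where
  toFun p :=
    { toFun := fun f => ⟨fun x => f.1 (p⁻¹ * x), fun x t =>
        (congrArg f.1 (mul_assoc _ _ _).symm).trans (apply_mul f _ t)⟩
      invFun := fun f => ⟨fun x => f.1 (p * x), fun x t =>
        (congrArg f.1 (mul_assoc _ _ _).symm).trans (apply_mul f _ t)⟩
      left_inv := fun f => Subtype.ext (funext fun x => by simp)
      right_inv := fun f => Subtype.ext (funext fun x => by simp)
      map_mul' := fun _ _ => rfl }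
  map_one' := by
    ext f x
    simp
  map_mul' p q := by
    ext f x
    simp [mul_assoc]

@[simp] theorem translate_apply (p : P) (f : twistedBase e) (x : P) :
    (translate e p f).1 x = f.1 (p⁻¹ * x) := rfl

theorem translate_translate_inv (p : P) (f : twistedBase e) :
    translate e p (translate e p⁻¹ f) = f := by
  rw [← MulAut.mul_apply, ← map_mul, mul_inv_cancel, map_one, MulAut.one_apply]

variable (he : Function.Injective e)

include he in
-- Equivariance only links values within one left coset of `e.range`, and injectivity of `e` makes
-- the parameter on the coset unique. So a value at `p` can be prescribed freely, with 1 on all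
-- other cosets.
theorem exists_delta (p : P) (u : T) : ∃ f : twistedBase e, f.1 p = u ∧
    (∀ x, p⁻¹ * x ∉ e.range → f.1 x = 1) := by
  classical
  refine ⟨⟨fun x => if h : ∃ t, e t = p⁻¹ * x then h.choose⁻¹ * u * h.choose else 1,
    fun x t => ?_⟩, ?_, fun x hx => ?_⟩
  · by_cases h : ∃ s, e s = p⁻¹ * x
    · have h' : ∃ s, e s = p⁻¹ * (x * e t) := by
        obtain ⟨s, hs⟩ := h
        exact ⟨s * t, by rw [map_mul, hs, mul_assoc]⟩
      have hst : h'.choose = h.choose * t := by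
        apply he
        rw [h'.choose_spec, map_mul, h.choose_spec, mul_assoc]
      simp only [dif_pos h, dif_pos h', hst]
      group
    · have h' : ¬ ∃ s, e s = p⁻¹ * (x * e t) := by
        rintro ⟨s, hs⟩
        exact h ⟨s * t⁻¹, by rw [map_mul, hs, map_inv]; group⟩
      simp only [dif_neg h, dif_neg h']
      group
  · have h : ∃ t, e t = p⁻¹ * p := ⟨1, by simp⟩
    have h1 : h.choose = 1 := by
      apply he
      rw [h.choose_spec]
      simp
    simp only [dif_pos h, h1]
    group
  · exact dif_neg hx

include he in
/-- The base group of a twisted wreath product is a direct power of `T`. -/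
theorem nonempty_mulEquiv : Nonempty (twistedBase e ≃* (P ⧸ e.range → T)) := by
  have hout : ∀ x : P, ∃ t : T, e t = (Quotient.out (x : P ⧸ e.range) : P)⁻¹ * x := fun x =>
    QuotientGroup.eq.1 (QuotientGroup.out_eq' (x : P ⧸ e.range))
  choose τ hτ using hout
  have hx : ∀ x : P, (Quotient.out (x : P ⧸ e.range) : P) * e (τ x) = x := fun x => by
    rw [hτ, mul_inv_cancel_left]
  have hτ1 : ∀ c : P ⧸ e.range, τ c.out = 1 := by
    intro c
    apply he
    rw [hτ, QuotientGroup.out_eq', inv_mul_cancel, map_one]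
  have hq : ∀ (x : P) (t : T), ((x * e t : P) : P ⧸ e.range) = x := by
    intro x t
    rw [eq_comm, QuotientGroup.eq]
    exact ⟨t, by simp⟩
  have hτm : ∀ (x : P) (t : T), τ (x * e t) = τ x * t := by
    intro x t
    apply he
    rw [hτ, hq, map_mul, hτ, mul_assoc]
  exact ⟨{
    toFun := fun f c => f.1 c.out
    invFun := fun g => ⟨fun x => (τ x)⁻¹ * g x * τ x, fun x t => by
      simp only [hq, hτm]
      group⟩
    left_inv := fun f => Subtype.ext (funext fun x => by
      change (τ x)⁻¹ * f.1 (Quotient.out (x : P ⧸ e.range)) * τ x = f.1 x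
      rw [← apply_mul, hx])
    right_inv := fun g => funext fun c => by
      change (τ c.out)⁻¹ * g ((c.out : P) : P ⧸ e.range) * τ c.out = g c
      rw [hτ1, QuotientGroup.out_eq']
      simp
    map_mul' := fun _ _ => rfl }⟩

section Invariant

variable (hT : IsNonabelianSimple T) {K : Subgroup (twistedBase e)}
  (hK : ∀ p, ∀ f ∈ K, translate e p f ∈ K)

include hT hK

/-- Translation by `e t` conjugates the value at 1 by `t`, so the values at 1 form a normal subgroup
of `T`; it is nontrivial because translation brings any value to 1. -/
theorem exists_mem_apply_one_eq (hne : K ≠ ⊥) (u : T) : ∃ f ∈ K, f.1 1 = u := by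
  have := hT.1
  let L : Subgroup T := K.map ((Pi.evalMonoidHom (fun _ : P => T) 1).comp (twistedBase e).subtype)
  have hL : L.Normal := by
    refine ⟨?_⟩
    rintro _ ⟨f, hf, rfl⟩ t
    refine ⟨translate e (e t) f, hK _ f hf, ?_⟩
    change f.1 ((e t)⁻¹ * 1) = t * f.1 1 * t⁻¹
    rw [mul_one, ← map_inv, ← one_mul (e t⁻¹), apply_mul, inv_inv]
  have hL' : L ≠ ⊥ := by
    intro hbot
    refine hne ((Subgroup.eq_bot_iff_forall K).2 fun f hf => Subtype.ext (funext fun p => ?_))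
    have : f.1 p ∈ L := ⟨translate e p⁻¹ f, hK _ f hf, by
      change f.1 (p⁻¹⁻¹ * 1) = f.1 p
      simp⟩
    rw [hbot] at this
    exact this
  have : u ∈ L := hL.eq_bot_or_eq_top.resolve_left hL' ▸ Subgroup.mem_top u
  exact this

/-- A commutator is trivial wherever one of its entries is, so vanishing sets accumulate, while the
values at 1 still form a normal subgroup of `T`. This subgroup is nontrivial since a nontrivial
value at 1 does not commute with all of `T`. -/
theorem exists_mem_vanishing
    (hdouble : ∀ x y, x ∉ e.range → y ∉ e.range → ∃ s t, y = e s * x * e t)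
    {f₀ : twistedBase e} (hf₀ : f₀ ∈ K) (h1 : f₀.1 1 = 1) {x₀ : P} (hx₀ : x₀ ∉ e.range)
    (hfx : f₀.1 x₀ ≠ 1) (S : Finset P) (hS : ∀ p ∈ S, p ∉ e.range) (u : T) :
    ∃ f ∈ K, (∀ p ∈ S, f.1 p = 1) ∧ f.1 1 = u := by
  classical
  have := hT.1
  have hsurj := exists_mem_apply_one_eq hT hK fun hbot => by
    rw [hbot, Subgroup.mem_bot] at hf₀
    exact hfx (by rw [hf₀]; rfl)
  have hpair : ∀ p, p ∉ e.range → ∃ f ∈ K, f.1 p = 1 ∧ f.1 1 ≠ 1 := by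
    intro p hp
    -- The double coset relation supplies a translate whose value at `p` comes from `f₀` on the
    -- coset of 1, and whose value at 1 comes from `f₀` on the coset of `x₀`.
    obtain ⟨s, t, hst⟩ := hdouble x₀ p⁻¹ hx₀ fun h => hp (by simpa using e.range.inv_mem h)
    refine ⟨translate e (p * e s) f₀, hK _ _ hf₀, ?_, ?_⟩
    · rw [translate_apply, show (p * e s)⁻¹ * p = 1 * e s⁻¹ by rw [map_inv]; group,
        apply_mul_eq_one_iff, h1]
    · rw [translate_apply, show (p * e s)⁻¹ * 1 = x₀ * e t by
        rw [mul_inv_rev, hst]; group, Ne, apply_mul_eq_one_iff]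
      exact hfx
  induction S using Finset.induction_on generalizing u with
  | empty =>
    obtain ⟨f, hf, hfu⟩ := hsurj u
    exact ⟨f, hf, by simp, hfu⟩
  | insert p S _ ih =>
    let L : Subgroup T :=
      { carrier := {u | ∃ f ∈ K, (∀ q ∈ insert p S, f.1 q = 1) ∧ f.1 1 = u}
        one_mem' := ⟨1, K.one_mem, fun _ _ => rfl, rfl⟩
        mul_mem' := by
          rintro _ _ ⟨f, hf, hfS, rfl⟩ ⟨g, hg, hgS, rfl⟩
          refine ⟨f * g, K.mul_mem hf hg, fun q hq => ?_, rfl⟩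
          change f.1 q * g.1 q = 1
          rw [hfS q hq, hgS q hq, one_mul]
        inv_mem' := by
          rintro _ ⟨f, hf, hfS, rfl⟩
          refine ⟨f⁻¹, K.inv_mem hf, fun q hq => ?_, rfl⟩
          change (f.1 q)⁻¹ = 1
          rw [hfS q hq, inv_one] }
    have hL : L.Normal := by
      refine ⟨?_⟩
      rintro _ ⟨f, hf, hfS, rfl⟩ t
      obtain ⟨g, hg, rfl⟩ := hsurj t
      refine ⟨g * f * g⁻¹, K.mul_mem (K.mul_mem hg hf) (K.inv_mem hg), fun q hq => ?_, rfl⟩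
      change g.1 q * f.1 q * (g.1 q)⁻¹ = 1
      rw [hfS q hq, mul_one, mul_inv_cancel]
    have hL' : L ≠ ⊥ := by
      intro hbot
      obtain ⟨g, hg, hgp, hg1⟩ := hpair p (hS p (Finset.mem_insert_self _ _))
      refine hg1 (hT.eq_one_of_central _ fun v => ?_)
      obtain ⟨f, hf, hfS, rfl⟩ := ih (fun q hq => hS q (Finset.mem_insert_of_mem hq)) v
      have hmem : f.1 1 * g.1 1 * (f.1 1)⁻¹ * (g.1 1)⁻¹ ∈ L := by
        refine ⟨f * g * f⁻¹ * g⁻¹, K.mul_mem (K.mul_mem (K.mul_mem hf hg) (K.inv_mem hf))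
          (K.inv_mem hg), fun q hq => ?_, rfl⟩
        change f.1 q * g.1 q * (f.1 q)⁻¹ * (g.1 q)⁻¹ = 1
        rcases Finset.mem_insert.1 hq with hqp | hq
        · rw [hqp, hgp]
          simp
        · rw [hfS q hq]
          simp
      rw [hbot, Subgroup.mem_bot, mul_inv_eq_one, mul_inv_eq_iff_eq_mul] at hmem
      exact hmem
    have : u ∈ L := hL.eq_bot_or_eq_top.resolve_left hL' ▸ Subgroup.mem_top u
    obtain ⟨f, hf, hfS, hfu⟩ := this
    exact ⟨f, hf, hfS, hfu⟩

/-- Vanishing on all of the complement of `e.range` yields elements of `K` supported on one coset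
with arbitrary value there; any equivariant function is assembled from these coset by coset. -/
theorem eq_top_of_exists_vanishing [Finite P]
    (hdouble : ∀ x y, x ∉ e.range → y ∉ e.range → ∃ s t, y = e s * x * e t)
    {f₀ : twistedBase e} (hf₀ : f₀ ∈ K) (h1 : f₀.1 1 = 1) {x₀ : P} (hx₀ : x₀ ∉ e.range)
    (hfx : f₀.1 x₀ ≠ 1) : K = ⊤ := by
  classical
  cases nonempty_fintype P
  have hdelta : ∀ (p : P) (u : T), ∃ f ∈ K, f.1 p = u ∧ ∀ x, p⁻¹ * x ∉ e.range → f.1 x = 1 := by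
    intro p u
    obtain ⟨f, hf, hfS, hf1⟩ := exists_mem_vanishing hT hK hdouble hf₀ h1 hx₀ hfx
      (Finset.univ.filter fun p => p ∉ e.range) (by simp) u
    refine ⟨translate e p f, hK _ _ hf, by simpa using hf1, fun x hx => ?_⟩
    rw [translate_apply]
    exact hfS _ (by simpa using hx)
  have key : ∀ (f : twistedBase e) (S : Finset P), ∃ g ∈ K, ∀ p ∈ S, g.1 p = f.1 p := by
    intro f S
    induction S using Finset.induction_on with
    | empty => exact ⟨1, K.one_mem, by simp⟩
    | insert p S _ ih =>
      obtain ⟨g, hg, hgS⟩ := ih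
      by_cases hp : ∃ s ∈ S, s⁻¹ * p ∈ e.range
      · obtain ⟨s, hs, t, ht⟩ := hp
        refine ⟨g, hg, fun q hq => ?_⟩
        rcases Finset.mem_insert.1 hq with rfl | hq
        · rw [← mul_inv_cancel_left s q, ← ht, apply_mul, apply_mul, hgS s hs]
        · exact hgS q hq
      · push Not at hp
        obtain ⟨h, hh, hhp, hhx⟩ := hdelta p ((g.1 p)⁻¹ * f.1 p)
        refine ⟨g * h, K.mul_mem hg hh, fun q hq => ?_⟩
        change g.1 q * h.1 q = f.1 q
        rcases Finset.mem_insert.1 hq with rfl | hq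
        · rw [hhp, mul_inv_cancel_left]
        · rw [hhx q fun hr => hp q hq (by simpa using e.range.inv_mem hr), mul_one, hgS q hq]
  refine (Subgroup.eq_top_iff' K).2 fun f => ?_
  obtain ⟨g, hg, hgf⟩ := key f Finset.univ
  rwa [show f = g from Subtype.ext (funext fun p => (hgf p (Finset.mem_univ p)).symm)]

omit hT in
/-- The elements of `P` that act on the invariant subgroup `K` as inner automorphisms of `K` form a
normal subgroup. -/
theorem exists_normal_inner : ∃ L : Subgroup P, L.Normal ∧
    ∀ p, p ∈ L ↔ ∃ m ∈ K, ∀ f ∈ K, translate e p f = m * f * m⁻¹ := by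
  refine ⟨
    { carrier := {p | ∃ m ∈ K, ∀ f ∈ K, translate e p f = m * f * m⁻¹}
      one_mem' := ⟨1, K.one_mem, fun f _ => by simp⟩
      mul_mem' := ?_
      inv_mem' := ?_ }, ⟨?_⟩, fun p => Iff.rfl⟩
  · rintro p q ⟨m, hm, hpm⟩ ⟨n, hn, hqn⟩
    refine ⟨m * n, K.mul_mem hm hn, fun f hf => ?_⟩
    rw [map_mul, MulAut.mul_apply, hqn f hf,
      hpm _ (K.mul_mem (K.mul_mem hn hf) (K.inv_mem hn))]
    group
  · rintro p ⟨m, hm, hpm⟩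
    refine ⟨m⁻¹, K.inv_mem hm, fun f hf => ?_⟩
    have h := hpm _ (K.mul_mem (K.mul_mem (K.inv_mem hm) hf) hm)
    rw [map_inv, MulAut.inv_apply, MulEquiv.symm_apply_eq, inv_inv, h]
    group
  · rintro p ⟨m, hm, hpm⟩ q
    refine ⟨translate e q m, hK _ _ hm, fun f hf => ?_⟩
    have h := hpm _ (hK q⁻¹ f hf)
    rw [map_mul, map_mul, MulAut.mul_apply, MulAut.mul_apply, h, map_mul, map_mul,
      translate_translate_inv, map_inv]

/-- If `K` were nontrivial, evaluation at 1 would identify it with `T`. The elements `e t` act on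
`K` as inner automorphisms, so by simplicity all of `P` does. The action is faithful, hence `P`
injects into `T`, which is too small. -/
theorem eq_bot_of_injective [Finite T] [IsSimpleGroup P] (hcard : Nat.card T < Nat.card P)
    (hinj : ∀ f ∈ K, f.1 1 = 1 → f = 1) : K = ⊥ := by
  by_contra hne
  have := hT.1
  have hsurj := exists_mem_apply_one_eq hT hK hne
  have hinj' : ∀ f ∈ K, ∀ g ∈ K, f.1 1 = g.1 1 → f = g := by
    intro f hf g hg h
    rw [← mul_inv_eq_one]
    refine hinj _ (K.mul_mem hf (K.inv_mem hg)) ?_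
    change f.1 1 * (g.1 1)⁻¹ = 1
    rw [h, mul_inv_cancel]
  obtain ⟨L, hL, hmem⟩ := exists_normal_inner hK
  have htr : ∀ t, ∀ f : twistedBase e, (translate e (e t) f).1 1 = t * f.1 1 * t⁻¹ := by
    intro t f
    rw [translate_apply, mul_one, ← map_inv, ← one_mul (e t⁻¹), apply_mul, inv_inv]
  have heL : ∀ t, e t ∈ L := by
    intro t
    obtain ⟨m, hm, rfl⟩ := hsurj t
    refine (hmem _).2 ⟨m, hm, fun f hf => hinj' _ (hK _ f hf) _
      (K.mul_mem (K.mul_mem hm hf) (K.inv_mem hm)) ?_⟩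
    rw [htr]
    rfl
  have hker : ∀ p : P, (∀ f ∈ K, translate e p f = f) → p = 1 := by
    let M : Subgroup P :=
      { carrier := {p | ∀ f ∈ K, translate e p f = f}
        one_mem' := fun f _ => by simp
        mul_mem' := fun {p q} hp hq f hf => by
          rw [map_mul, MulAut.mul_apply, hq f hf, hp f hf]
        inv_mem' := fun {p} hp f hf => by
          rw [map_inv, MulAut.inv_apply, MulEquiv.symm_apply_eq, hp f hf] }
    have hM : M.Normal := by
      refine ⟨fun p hp q f hf => ?_⟩
      rw [map_mul, map_mul, MulAut.mul_apply, MulAut.mul_apply, hp _ (hK q⁻¹ f hf),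
        translate_translate_inv]
    have hbot : M = ⊥ := by
      refine hM.eq_bot_or_eq_top.resolve_right fun htop => hT.2 fun a b => ?_
      obtain ⟨f, hf, rfl⟩ := hsurj b
      have : e a ∈ M := htop ▸ Subgroup.mem_top _
      have h := htr a f
      rw [this f hf, eq_comm, mul_inv_eq_iff_eq_mul] at h
      exact h
    intro p hp
    have : p ∈ M := hp
    rwa [hbot, Subgroup.mem_bot] at this
  have htop : L = ⊤ := by
    refine hL.eq_bot_or_eq_top.resolve_left fun hbot => hT.2 fun a b => ?_
    obtain ⟨f, hf, rfl⟩ := hsurj b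
    have h := htr a f
    have ha := heL a
    rw [hbot, Subgroup.mem_bot] at ha
    rw [ha, map_one, MulAut.one_apply, eq_comm, mul_inv_eq_iff_eq_mul] at h
    exact h
  choose m hm hpm using fun p => (hmem p).1 (htop ▸ Subgroup.mem_top p)
  have hmi : Function.Injective fun p => (m p).1 1 := by
    intro p q hpq
    have hpq' := hinj' _ (hm p) _ (hm q) hpq
    rw [← inv_mul_eq_one]
    refine hker _ fun f hf => ?_
    rw [map_mul, MulAut.mul_apply, map_inv, MulAut.inv_apply, MulEquiv.symm_apply_eq, hpm, hpm,
      hpq'] <;> exact hf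
  exact absurd (Nat.card_le_card_of_injective _ hmi) (not_le.2 hcard)

/-- Either some element of `K` is trivial at 1 and nontrivial on another coset, and then `K` is
everything; or evaluation at 1 is injective on `K`, a diagonal situation excluded by the orders of
`T` and `P`. -/
theorem eq_bot_or_eq_top [Finite T] [Finite P] [IsSimpleGroup P]
    (hcard : Nat.card T < Nat.card P)
    (hdouble : ∀ x y, x ∉ e.range → y ∉ e.range → ∃ s t, y = e s * x * e t) :
    K = ⊥ ∨ K = ⊤ := by
  by_cases h : ∃ f ∈ K, f.1 1 = 1 ∧ ∃ x ∉ e.range, f.1 x ≠ 1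
  · obtain ⟨f, hf, h1, x, hx, hfx⟩ := h
    exact Or.inr (eq_top_of_exists_vanishing hT hK hdouble hf h1 hx hfx)
  · push Not at h
    refine Or.inl (eq_bot_of_injective hT hK hcard fun f hf h1 => ?_)
    refine Subtype.ext (funext fun x => ?_)
    by_cases hx : x ∈ e.range
    · obtain ⟨t, rfl⟩ := hx
      have := (apply_mul_eq_one_iff f 1 t).2 h1
      rwa [one_mul] at this
    · exact h f hf h1 x hx

end Invariant

end twistedBase

/-- The twisted wreath product of `T` by `P` along `e : T →* P`. -/
def TwistedWreathProduct (e : T →* P) := twistedBase e ⋊[twistedBase.translate e] P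

namespace TwistedWreathProduct

open twistedBase

variable {e : T →* P}

instance : Group (TwistedWreathProduct e) :=
  inferInstanceAs (Group (twistedBase e ⋊[translate e] P))

/-- The embedding of the base group. -/
def inl : twistedBase e →* TwistedWreathProduct e := SemidirectProduct.inl

/-- The embedding of the top group. -/
def inr : P →* TwistedWreathProduct e := SemidirectProduct.inr

/-- The projection to the top group. -/
def top : TwistedWreathProduct e →* P := SemidirectProduct.rightHom

instance : MulAction (TwistedWreathProduct e) (twistedBase e) where
  smul g f := g.left * translate e g.right f
  one_smul f := by
    change 1 * translate e 1 f = f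
    simp
  mul_smul g h f := by
    change g.left * translate e g.right h.left * translate e (g.right * h.right) f =
      g.left * translate e g.right (h.left * translate e h.right f)
    simp [mul_assoc]

theorem smul_def (g : TwistedWreathProduct e) (f : twistedBase e) :
    g • f = g.left * translate e g.right f := rfl

theorem inl_smul (n f : twistedBase e) : (inl n : TwistedWreathProduct e) • f = n * f := by
  change n * translate e 1 f = n * f
  simp

theorem inr_smul (p : P) (f : twistedBase e) :
    (inr p : TwistedWreathProduct e) • f = translate e p f := by
  change 1 * translate e p f = translate e p f
  simp

variable (hT : IsNonabelianSimple T) (he : Function.Injective e)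
  (hcard : Nat.card T < Nat.card P)
  (hdouble : ∀ x y, x ∉ e.range → y ∉ e.range → ∃ s t, y = e s * x * e t)

include hcard in
theorem exists_notMem_range [Finite T] : ∃ p, p ∉ e.range := by
  by_contra h
  push Not at h
  exact absurd (Nat.card_le_card_of_surjective e h) (not_le.2 hcard)

include hT he hcard

/-- Elements outside the base group act on the base group by outer automorphisms. -/
theorem eq_one_of_translate_eq_conj [Finite T] [IsSimpleGroup P] {p : P} {n : twistedBase e}
    (h : ∀ f, translate e p f = n * f * n⁻¹) : p = 1 := by
  have := hT.1
  obtain ⟨L, hL, hmem⟩ := exists_normal_inner (e := e) (K := ⊤) fun _ _ _ => Subgroup.mem_top _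
  have hp : p ∈ L := (hmem p).2 ⟨n, Subgroup.mem_top _, fun f _ => h f⟩
  rcases hL.eq_bot_or_eq_top with hbot | htop
  · rwa [hbot, Subgroup.mem_bot] at hp
  · exfalso
    obtain ⟨q, hq⟩ := exists_notMem_range (e := e) hcard
    obtain ⟨m, -, hm⟩ := (hmem q).1 (htop ▸ Subgroup.mem_top q)
    obtain ⟨u, hu⟩ := exists_ne (1 : T)
    -- Conjugation preserves supports, but translation by `q` outside `e.range` moves the coset
    -- carrying this function.
    obtain ⟨f, hf1, hf⟩ := exists_delta he 1 u
    have h1 : f.1 (q⁻¹ * 1) = m.1 1 * f.1 1 * (m.1 1)⁻¹ :=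
      congrFun (congrArg Subtype.val (hm f (Subgroup.mem_top f))) 1
    rw [hf _ fun h => hq (by simpa using e.range.inv_mem h), hf1, eq_comm, mul_inv_eq_one] at h1
    exact hu (by simpa using h1)

/-- An element centralising the base group has a top part acting as an inner automorphism, so that
part is trivial; the remaining base part is then central in `T` at every point. -/
theorem eq_one_of_forall_conj [Finite T] [IsSimpleGroup P] {g : TwistedWreathProduct e}
    (h : ∀ f, inl f * g = g * inl f) : g = 1 := by
  have h1 : ∀ f : twistedBase e, f * g.left = g.left * translate e g.right f := by
    intro f
    have h2 := congrArg SemidirectProduct.left (h f)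
    change f * translate e 1 g.left = g.left * translate e g.right f at h2
    simpa using h2
  have hr : g.right = 1 := eq_one_of_translate_eq_conj hT he hcard (n := g.left⁻¹) fun f => by
    rw [inv_inv, mul_assoc, h1, inv_mul_cancel_left]
  have hl : g.left = 1 := by
    refine Subtype.ext (funext fun p => hT.eq_one_of_central _ fun u => ?_)
    obtain ⟨f, rfl, -⟩ := exists_delta he p u
    have h2 := h1 f
    rw [hr, map_one, MulAut.one_apply] at h2
    exact congrFun (congrArg Subtype.val h2) p
  exact SemidirectProduct.ext hl hr

include hdouble

omit he in
theorem isPreprimitive [Finite T] [Finite P] [IsSimpleGroup P] :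
    IsPreprimitive (TwistedWreathProduct e) (twistedBase e) := by
  refine isPreprimitive_of_invariant_subgroups (fun n => ⟨inl n, fun x => inl_smul n x⟩)
    fun K hK => eq_bot_or_eq_top hT (fun p f hf => ?_) hcard hdouble
  rw [← inr_smul]
  exact hK _ (by rw [inr_smul, map_one]) f hf

theorem isMonolith [Finite T] [Finite P] [IsSimpleGroup P] :
    IsMonolith (inl : twistedBase e →* TwistedWreathProduct e).range := by
  have := hT.1
  have hinl : Function.Injective (inl : twistedBase e →* TwistedWreathProduct e) :=
    SemidirectProduct.inl_injective
  have hnormal : (inl : twistedBase e →* TwistedWreathProduct e).range.Normal := by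
    have : (inl : twistedBase e →* TwistedWreathProduct e).range = top.ker :=
      SemidirectProduct.range_inl_eq_ker_rightHom
    rw [this]
    exact MonoidHom.normal_ker _
  refine ⟨hnormal, fun hbot => ?_, fun K hK hne => ?_⟩
  · obtain ⟨u, hu⟩ := exists_ne (1 : T)
    obtain ⟨f, hf, -⟩ := exists_delta he 1 u
    have : (inl f : TwistedWreathProduct e) ∈
      (inl : twistedBase e →* TwistedWreathProduct e).range := ⟨f, rfl⟩
    rw [hbot, Subgroup.mem_bot, map_eq_one_iff inl hinl] at this
    exact hu (by rw [← hf, this]; rfl)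
  · have hconj : ∀ p f, (inl (translate e p f) : TwistedWreathProduct e) =
        inr p * inl f * (inr p)⁻¹ := fun p f => by
      rw [← map_inv]
      exact SemidirectProduct.inl_aut p f
    rcases eq_bot_or_eq_top hT (K := K.comap inl) (fun p f hf => by
      rw [Subgroup.mem_comap, hconj]
      exact hK.conj_mem _ hf _) hcard hdouble with hbot | htop
    -- If `K` meets the base group trivially, then the commutators of `K` with the base group, lying
    -- in both, vanish; so `K` centralises the base group.
    · exfalso
      obtain ⟨g, hg, hg1⟩ := Subgroup.exists_mem_ne_one hne
      refine hg1 (eq_one_of_forall_conj hT he hcard fun f => ?_)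
      obtain ⟨c, hc⟩ : g * inl f⁻¹ * g⁻¹ ∈ (inl : twistedBase e →* TwistedWreathProduct e).range :=
        hnormal.conj_mem _ ⟨_, rfl⟩ _
      have hmem : f * c ∈ K.comap inl := by
        rw [Subgroup.mem_comap, map_mul, hc]
        have := K.mul_mem (hK.conj_mem _ hg (inl f)) (K.inv_mem hg)
        simpa [mul_assoc] using this
      rw [hbot, Subgroup.mem_bot] at hmem
      have h2 : (inl f : TwistedWreathProduct e) * (g * inl f⁻¹ * g⁻¹) = 1 := by
        rw [← hc, ← map_mul, hmem, map_one]
      rw [← mul_assoc, mul_inv_eq_one, map_inv, ← mul_assoc, mul_inv_eq_iff_eq_mul] at h2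
      exact h2
    · rintro _ ⟨f, rfl⟩
      have : f ∈ K.comap inl := htop ▸ Subgroup.mem_top f
      exact this

theorem isProductFactor [Finite T] [Finite P] [IsSimpleGroup P]
    (hinv : ∃ t : T, t ≠ 1 ∧ t * t = 1) :
    IsProductFactor (TwistedWreathProduct e) (twistedBase e) := by
  have hprim := isPreprimitive hT hcard hdouble
  have := hT.1
  refine ⟨Subtype.finite, faithfulSMul_of_eq_one fun g hg => ?_, hprim,
    moves_of_base 1 fun b hb => ?_, ?_⟩
  · have hl : g.left = 1 := by
      have := hg 1
      rwa [smul_def, map_one, mul_one] at this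
    have hr : g.right = 1 := eq_one_of_translate_eq_conj hT he hcard (n := 1) fun f => by
      have := hg f
      rw [smul_def, hl, one_mul] at this
      simpa using this
    exact SemidirectProduct.ext hl hr
  · by_contra hcon
    push Not at hcon
    have hfix : ∀ p, translate e p b = b := by
      intro p
      have := hcon (inr p) (by rw [inr_smul, map_one])
      rwa [inr_smul] at this
    -- If every stabilising element fixed `b`, then `b` would lie in the invariant subgroup of
    -- `P`-fixed functions. By the dichotomy that subgroup would be everything and `P` would act
    -- trivially.
    let K : Subgroup (twistedBase e) :=
      { carrier := {f | ∀ p, translate e p f = f}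
        one_mem' := fun p => map_one _
        mul_mem' := fun hf hg p => by rw [map_mul, hf p, hg p]
        inv_mem' := fun hf p => by rw [map_inv, hf p] }
    rcases eq_bot_or_eq_top hT (K := K) (fun p f hf => by rwa [hf p]) hcard hdouble with h | h
    · have : b ∈ K := hfix
      rw [h, Subgroup.mem_bot] at this
      exact hb this
    · obtain ⟨q, hq⟩ := exists_notMem_range (e := e) hcard
      refine hq ⟨1, ?_⟩
      rw [map_one]
      refine (eq_one_of_translate_eq_conj hT he hcard (p := q) (n := 1) fun f => ?_).symm
      have : f ∈ K := h ▸ Subgroup.mem_top f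
      rw [this q]
      simp
  · obtain ⟨t, ht, ht2⟩ := hinv
    obtain ⟨f, hf, hfx⟩ := exists_delta he 1 t
    have hff : f * f = 1 := by
      refine Subtype.ext (funext fun x => ?_)
      change f.1 x * f.1 x = 1
      by_cases hx : 1⁻¹ * x ∈ e.range
      · obtain ⟨s, hs⟩ := hx
        have hx' : x = 1 * e s := by rw [hs]; simp
        rw [hx', apply_mul, hf]
        calc s⁻¹ * t * s * (s⁻¹ * t * s) = s⁻¹ * (t * t) * s := by group
          _ = 1 := by rw [ht2]; group
      · rw [hfx x hx, one_mul]
    refine ⟨1, f, fun h => ht ?_, inl f, by rw [inl_smul, mul_one], by rw [inl_smul, hff]⟩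
    rw [← hf, ← h]
    rfl

omit hT he hcard hdouble in
theorem actsRegularly :
    ActsRegularly (inl : twistedBase e →* TwistedWreathProduct e).range (twistedBase e) := by
  refine ⟨⟨fun x y => ⟨⟨inl (y * x⁻¹), _, rfl⟩, ?_⟩⟩, fun α => ?_⟩
  · rw [Subgroup.smul_def, inl_smul, inv_mul_cancel_right]
  · rw [Subgroup.eq_bot_iff_forall]
    rintro ⟨_, n, rfl⟩ hn
    rw [mem_stabilizer_iff, Subgroup.smul_def, inl_smul, mul_eq_right] at hn
    subst hn
    exact Subtype.ext (map_one _)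

omit hT hdouble in
theorem nonempty_range_inl_equiv [Finite T] [Finite P] :
    ∃ n, 2 ≤ n ∧
      Nonempty ((inl : twistedBase e →* TwistedWreathProduct e).range ≃* (Fin n → T)) := by
  obtain ⟨f⟩ := nonempty_mulEquiv he
  have hinl : Function.Injective (inl : twistedBase e →* TwistedWreathProduct e) :=
    SemidirectProduct.inl_injective
  refine ⟨Nat.card (P ⧸ e.range), ?_, ⟨((MonoidHom.ofInjective hinl).symm.trans f).trans
    (MulEquiv.arrowCongr (Finite.equivFin _) (MulEquiv.refl T))⟩⟩
  obtain ⟨q, hq⟩ := exists_notMem_range (e := e) hcard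
  have : Nontrivial (P ⧸ e.range) := by
    refine ⟨(1 : P), (q : P), fun h => hq ?_⟩
    simpa using QuotientGroup.eq.1 h
  exact Finite.one_lt_card

end TwistedWreathProduct

end Twisted

/-! ### Alternating groups on points, and the small factors -/

namespace alternatingGroup

theorem isMultiplyPretransitive_fin {k n : ℕ} (h : k + 2 ≤ n) :
    IsMultiplyPretransitive (alternatingGroup (Fin n)) (Fin n) k := by
  have := alternatingGroup.isMultiplyPretransitive (Fin n)
  rw [Nat.card_eq_fintype_card, Fintype.card_fin] at this
  exact isMultiplyPretransitive_of_le (n := n - 2) (by omega) (by simp)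

/-- An alternating group of large degree is transitive on the flags of the geometry in which points
of distinct types are incident when they are distinct. -/
theorem exists_isUniform_fin {k n : ℕ} (hn : k + 5 ≤ n) :
    ∃ (X : Type) (_ : Finite X) (_ : MulAction (alternatingGroup (Fin n)) X)
      (Γ : Pregeometry X (Fin k)), Γ.IsUniform (alternatingGroup (Fin n)) (Fin n) := by
  classical
  have : NeZero n := ⟨by omega⟩
  have := isPreprimitive_of_three_le_card (Fin n) (by simp; omega)
  have := isMultiplyPretransitive_fin (show k + 2 ≤ n by omega)
  refine ⟨Σ _ : Fin k, Fin n, inferInstance, inferInstance,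
    Pregeometry.ofRelations (fun i j x y => i = j ↔ x = y) (by simp)
      (fun i j x y h => by rw [eq_comm, h, eq_comm]), ?_⟩
  refine Pregeometry.isUniform_ofRelations (fun J x hx i hi => ?_) (fun g i j x y h => ?_)
    fun x y hx hy => ?_
  -- Avoid all values of `x`, including irrelevant ones off `J`: at most `k` points are lost,
  -- leaving at least five.
  · have hsub : ((Finset.univ.image x)ᶜ : Finset (Fin n)) ≤
        ({z | ∀ j ∈ J, i = j ↔ z = x j} : Set (Fin n)) := by
      intro z hz j hj
      have hij : i ≠ j := fun h => hi (h ▸ hj)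
      simp only [Finset.coe_compl, Finset.coe_image, Finset.coe_univ, Set.image_univ,
        Set.mem_compl_iff, Set.mem_range, not_exists] at hz
      exact iff_of_false hij fun h => hz j h.symm
    refine le_trans ?_ (Set.encard_le_encard hsub)
    rw [Set.encard_coe_eq_coe_finsetCard, Finset.card_compl, Fintype.card_fin]
    have h1 := Finset.card_image_le (s := Finset.univ) (f := x)
    rw [Finset.card_univ, Fintype.card_fin] at h1
    exact_mod_cast (show 3 ≤ n - (Finset.univ.image x).card by omega)
  · rw [h, smul_left_cancel_iff]
  · obtain ⟨g, hg⟩ := exists_smul_eq (alternatingGroup (Fin n))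
      (⟨x, fun i j h => (hx i j).2 h⟩ : Fin k ↪ Fin n) ⟨y, fun i j h => (hy i j).2 h⟩
    exact ⟨g, fun i => congrArg (fun f : Fin k ↪ Fin n => f i) hg⟩

theorem isPrimitiveGroupOfType_AS {n : ℕ} (hn : 5 ≤ n) :
    IsPrimitiveGroupOfType .AS (alternatingGroup (Fin n)) (Fin n) := by
  have hT := isNonabelianSimple (α := Fin n) (by simpa using hn)
  have := hT.1
  exact ⟨inferInstance, Fin.nontrivial_iff_two_le.2 (by omega), inferInstance,
    isPreprimitive_of_three_le_card (Fin n) (by simp; omega),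
    alternatingGroup (Fin n), inferInstance, hT, ⊤, isMonolith_top.isUniqueMinimalNormal,
    ⟨Subgroup.topEquiv⟩⟩

theorem isNonabelianSimple_five : IsNonabelianSimple (alternatingGroup (Fin 5)) :=
  isNonabelianSimple (by simp)

theorem exists_involution_five : ∃ t : alternatingGroup (Fin 5), t ≠ 1 ∧ t * t = 1 :=
  ⟨⟨Equiv.swap 0 1 * Equiv.swap 2 3, Equiv.Perm.mem_alternatingGroup.2 (by decide)⟩, by decide, by decide⟩

theorem isProductFactor_five : IsProductFactor (alternatingGroup (Fin 5)) (Fin 5) := by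
  have h2 : ∀ {a b c d : Fin 5}, a ≠ b → c ≠ d →
      ∃ g : alternatingGroup (Fin 5), g • a = c ∧ g • b = d :=
    is_two_pretransitive_iff.1 (isMultiplyPretransitive_fin (by norm_num))
  refine ⟨inferInstance, inferInstance, isPreprimitive_of_three_le_card (Fin 5) (by simp),
    fun a b hab => ?_, ⟨0, 1, by decide, h2 (by decide) (by decide)⟩⟩
  obtain ⟨c, hca, hcb⟩ : ∃ c : Fin 5, c ≠ a ∧ c ≠ b := by
    revert a b
    decide
  obtain ⟨g, hga, hgb⟩ := h2 hab hca.symm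
  exact ⟨g, hga, by rwa [hgb]⟩

theorem card_five : Nat.card (alternatingGroup (Fin 5)) = 60 := by
  rw [nat_card_alternatingGroup, Nat.card_eq_fintype_card, Fintype.card_fin]
  rfl

theorem card_stabilizer_top_five (a : Fin 5) :
    Nat.card (stabilizer (⊤ : Subgroup (alternatingGroup (Fin 5))) a) = 12 := by
  have h := isProductFactor_five.primitive.toIsPretransitive
  have : IsPretransitive (⊤ : Subgroup (alternatingGroup (Fin 5))) (Fin 5) := by
    refine ⟨fun x y => ?_⟩
    obtain ⟨g, hg⟩ := h.exists_smul_eq x y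
    exact ⟨⟨g, trivial⟩, hg⟩
  have h1 := (stabilizer (⊤ : Subgroup (alternatingGroup (Fin 5))) a).card_mul_index
  rw [index_stabilizer_of_transitive, Nat.card_eq_fintype_card (α := Fin 5), Fintype.card_fin,
    Subgroup.card_top, card_five] at h1
  omega

end alternatingGroup

theorem isProductFactor_perm_three : IsProductFactor (Equiv.Perm (Fin 3)) (Fin 3) :=
  ⟨inferInstance, inferInstance, inferInstance, by decide, by decide⟩

set_option maxRecDepth 10000 in
theorem isMonolith_alternatingGroup_three : IsMonolith (alternatingGroup (Fin 3)) := by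
  refine ⟨inferInstance, fun h => ?_, fun K hK hne => ?_⟩
  · have : (Equiv.swap 0 1 * Equiv.swap 1 2 : Equiv.Perm (Fin 3)) ∈ alternatingGroup (Fin 3) :=
      Equiv.Perm.mem_alternatingGroup.2 (by decide)
    rw [h, Subgroup.mem_bot] at this
    exact absurd this (by decide)
  · obtain ⟨g, hg, hg1⟩ := Subgroup.exists_mem_ne_one hne
    intro a ha
    -- In `S₃`, products of two conjugates of any nontrivial element already give all nontrivial
    -- even permutations.
    have key : ∀ g a : Equiv.Perm (Fin 3), g ≠ 1 → Equiv.Perm.sign a = 1 →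
        a = 1 ∨ ∃ x y, a = x * g * x⁻¹ * (y * g * y⁻¹) := by
      decide
    rcases key g a hg1 ha with rfl | ⟨x, y, rfl⟩
    · exact K.one_mem
    · exact K.mul_mem (hK.conj_mem g hg x) (hK.conj_mem g hg y)

/-- The embedding of an alternating group as a point stabiliser in the next one. -/
def alternatingGroup.optionHom (α : Type*) [Fintype α] [DecidableEq α] :
    alternatingGroup α →* alternatingGroup (Option α) where
  toFun g := ⟨Equiv.optionCongr g.1, by
    rw [Equiv.Perm.mem_alternatingGroup, Equiv.optionCongr_sign]
    exact Equiv.Perm.mem_alternatingGroup.1 g.2⟩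
  map_one' := Subtype.ext Equiv.optionCongr_refl
  map_mul' g h := Subtype.ext (Equiv.optionCongr_trans h.1 g.1)

namespace alternatingGroup

variable {α : Type*} [Fintype α] [DecidableEq α]

theorem optionHom_injective : Function.Injective (optionHom α) := fun _ _ h =>
  Subtype.ext (Equiv.optionCongr_injective (congrArg Subtype.val h))

theorem mem_range_optionHom {g : alternatingGroup (Option α)} :
    g ∈ (optionHom α).range ↔ g • (none : Option α) = none := by
  constructor
  · rintro ⟨h, rfl⟩
    rfl
  · intro hg
    have hg' : g.1 none = none := hg
    have h : Equiv.optionCongr (Equiv.removeNone g.1) = g.1 := by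
      rw [map_equiv_removeNone, hg', Equiv.swap_self]
      rfl
    refine ⟨⟨Equiv.removeNone g.1, ?_⟩, Subtype.ext h⟩
    rw [Equiv.Perm.mem_alternatingGroup, ← Equiv.optionCongr_sign, h]
    exact Equiv.Perm.mem_alternatingGroup.1 g.2

/-- The range of `optionHom` is the stabiliser of `none`, and 2-transitivity makes it transitive on
the remaining points, so only one double coset lies outside it. -/
theorem exists_double_coset
    (h2 : IsMultiplyPretransitive (alternatingGroup (Option α)) (Option α) 2)
    (x y : alternatingGroup (Option α)) (hx : x ∉ (optionHom α).range)
    (hy : y ∉ (optionHom α).range) : ∃ s t, y = optionHom α s * x * optionHom α t := by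
  rw [mem_range_optionHom] at hx hy
  obtain ⟨g, hg, hgx⟩ := is_two_pretransitive_iff.1 h2 (Ne.symm hx) (Ne.symm hy)
  obtain ⟨s, rfl⟩ := mem_range_optionHom.2 hg
  obtain ⟨t, ht⟩ := mem_range_optionHom.2
    (show ((optionHom α s * x)⁻¹ * y) • (none : Option α) = none by
      rw [mul_smul, inv_smul_eq_iff, mul_smul, hgx])
  exact ⟨s, t, by rw [ht, mul_inv_cancel_left]⟩

end alternatingGroup

/-! ### The eight types -/

theorem theorem1p1 (k : ℕ) (hk : 1 ≤ k) (τ : ONanScottType) :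
    ∃ (Ω G : Type) (_ : Group G) (_ : MulAction G Ω), IsPrimitiveGroupOfType τ G Ω ∧
      ∃ (X : Type) (_ : Finite X) (_ : MulAction G X) (Γ : Pregeometry X (Fin k)),
        Γ.IsUniform G Ω := by
  have hT := alternatingGroup.isNonabelianSimple_five
  have hinv := alternatingGroup.exists_involution_five
  have hm : 0 < 2 * (k + 2) := by omega
  have hm' : 2 ≤ 2 * (k + 2) := by omega
  have hN : IsNonabelianSimple (alternatingGroup (Fin (6 * (k + 2)))) :=
    alternatingGroup.isNonabelianSimple (by rw [Fintype.card_fin]; omega)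
  have hNs := hN.1
  cases τ with
  | HA =>
    have hH := isProductFactor_perm_three
    have h3 : ∀ a b : Equiv.Perm (Fin 3), Equiv.Perm.sign a = 1 → Equiv.Perm.sign b = 1 →
        a * b = b * a := by
      decide
    exact ⟨_, _, _, _, hH.isPrimitiveGroupOfType_wreathProduct hm
      (hH.definingProperty_HA isMonolith_alternatingGroup_three (fun a ha b hb => h3 a b ha hb) hm),
      hH.exists_isUniform k le_rfl⟩
  | HS =>
    exact ⟨_, _, _, _, ⟨inferInstance, hNs.toNontrivial, TwoSided.faithfulSMul hN,
      TwoSided.containsTwoSided.isPreprimitive, TwoSided.definingProperty_HS hN⟩,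
      TwoSided.exists_isUniform le_rfl⟩
  | HC =>
    have hH := TwoSided.containsTwoSided.isProductFactor hT (TwoSided.faithfulSMul hT) hinv
    exact ⟨_, _, _, _, hH.isPrimitiveGroupOfType_wreathProduct hm
      (hH.definingProperty_HC hT (TwoSided.isBimonolith hT) TwoSided.leftEquiv
        TwoSided.rightEquiv hm'), hH.exists_isUniform k le_rfl⟩
  | AS =>
    exact ⟨_, _, _, _, alternatingGroup.isPrimitiveGroupOfType_AS (n := k + 5) (by omega),
      alternatingGroup.exists_isUniform_fin le_rfl⟩
  | SD =>
    exact ⟨_, _, _, _, ⟨inferInstance, hNs.toNontrivial, WreathProduct.faithfulSMul_two hN,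
      WreathProduct.containsTwoSided.isPreprimitive, WreathProduct.definingProperty_SD hN⟩,
      WreathProduct.exists_isUniform_two le_rfl⟩
  | CD =>
    have hH := WreathProduct.containsTwoSided.isProductFactor hT
      (WreathProduct.faithfulSMul_two hT) hinv
    exact ⟨_, _, _, _, hH.isPrimitiveGroupOfType_wreathProduct hm
      (hH.definingProperty_CD hT (WreathProduct.isMonolith_baseSubgroup_top hT (Fin 2))
        one_le_two (WreathProduct.baseSubgroupTopEquiv _)
        (fun α => ⟨WreathProduct.stabilizerTwoEquiv α⟩) hm'), hH.exists_isUniform k le_rfl⟩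
  | TW =>
    have hc : Nat.card (Option (Fin 5)) = 6 := by simp
    have hP : IsSimpleGroup (alternatingGroup (Option (Fin 5))) :=
      alternatingGroup.isSimpleGroup (by rw [hc]; norm_num)
    have hcard : Nat.card (alternatingGroup (Fin 5)) <
        Nat.card (alternatingGroup (Option (Fin 5))) := by
      rw [alternatingGroup.card_five, nat_card_alternatingGroup, hc]
      decide
    have h4 := alternatingGroup.isMultiplyPretransitive (Option (Fin 5))
    rw [hc] at h4
    have hdouble := alternatingGroup.exists_double_coset (α := Fin 5)
      (isMultiplyPretransitive_of_le (n := 6 - 2) (by norm_num) (by rw [hc]; norm_num))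
    have he := alternatingGroup.optionHom_injective (α := Fin 5)
    have hH := TwistedWreathProduct.isProductFactor hT he hcard hdouble hinv
    obtain ⟨n, hn, ⟨f⟩⟩ := TwistedWreathProduct.nonempty_range_inl_equiv he hcard
    exact ⟨_, _, _, _, hH.isPrimitiveGroupOfType_wreathProduct hm
      (hH.definingProperty_TW hT (TwistedWreathProduct.isMonolith hT he hcard hdouble) hn f
        TwistedWreathProduct.actsRegularly hm), hH.exists_isUniform k le_rfl⟩
  | PA =>
    have hH := alternatingGroup.isProductFactor_five
    have := hT.1
    exact ⟨_, _, _, _, hH.isPrimitiveGroupOfType_wreathProduct hm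
      -- The prime 5 divides the order 60 of `A₅` but not the order 12 of a point stabiliser.
      (hH.definingProperty_PA hT isMonolith_top Subgroup.topEquiv (p := 5) (by norm_num)
        (by rw [alternatingGroup.card_five]; norm_num) (fun a => ⟨by
          rw [alternatingGroup.card_stabilizer_top_five]; norm_num, fun h => by
          have h1 := alternatingGroup.card_stabilizer_top_five a
          rw [h, Subgroup.card_bot] at h1
          omega⟩) hm'), hH.exists_isUniform k le_rfl⟩
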